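/- Let $(M^n,g)$, $n\ge 4$, be a generalized Robertson--Walker (GRW) spacetime, that is, a smooth Lorentzian manifold of signature $(+,\dots,+,-)$ which can be presented as a warped product $-J\times_{a^2}M^{*}$, where $J\subseteq\mathbb R$ is an open interval, $(M^{*},g^{*})$ is an $(n-1)$-dimensional Riemannian manifold, $a>0$ is a smooth function on $J$, and $g=-dt^2+a(t)^2g^{*}$. Let $\rho=\partial_t$ be its unit timelike vector field. It is an eigenvector field of the Ricci tensor $S$, say $S(U,\rho)=\xi\,g(U,\rho)$ for all $U$, and it is assumed that the eigenvalue $\xi$ is non-zero (it is enough that the function $\xi$ does not vanish identically). Suppose that $(M,g)$ admits a gradient $\tau$-Einstein soliton, i.e. there are a smooth function $f:M\to\mathbb R$ (the potential function) and real constants $\lambda_1,\tau$ with $$\operatorname{Hess} f+S=(\lambda_1+\tau r)\,g,$$ where $r$ is the scalar curvature of $g$. Then the gradient $Df$ of the potential function is pointwise collinear with $\rho$; namely $$Df=-(\rho f)\,\rho\qquad\text{on } M.$$ -/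

import Mathlib

open scoped Manifold ContDiff

noncomputable section

/-! ### Coordinate formulas

`G` is a metric in coordinates on (an open part of) a finite-dimensional real vector space `E`;
`G y` is the bilinear form at the point `y`. -/

namespace Coord

variable {E : Type*} [NormedAddCommGroup E] [NormedSpace ℝ E] [FiniteDimensional ℝ E]

/-- The Christoffel symbols `Γ_y(u, v)`: the vector determined by
`G_y(Γ_y(u, v), z) = ½ ((∂_u G)(v, z) + (∂_v G)(u, z) - (∂_z G)(u, v))` for all `z`. -/
def christoffel (G : E → E →L[ℝ] E →L[ℝ] ℝ) (y u v : E) : E :=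
  (G y).inverse ((1 / 2 : ℝ) •
    (fderiv ℝ G y u v + fderiv ℝ G y v u - ((fderiv ℝ G y).flip u).flip v))

/-- The curvature `R(u, v) w = ∇_u ∇_v w - ∇_v ∇_u w` for constant coordinate fields. -/
def riemann (G : E → E →L[ℝ] E →L[ℝ] ℝ) (y u v w : E) : E :=
  fderiv ℝ (fun z => christoffel G z v w) y u - fderiv ℝ (fun z => christoffel G z u w) y v
    + christoffel G y u (christoffel G y v w) - christoffel G y v (christoffel G y u w)

/-- The Ricci tensor `Ric(v, w)`, the trace of `u ↦ R(u, v) w`. -/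
def ricci (G : E → E →L[ℝ] E →L[ℝ] ℝ) (y v w : E) : ℝ :=
  ∑ i, (Module.finBasis ℝ E).coord i (riemann G y (Module.finBasis ℝ E i) v w)

/-- The scalar curvature, the metric trace of the Ricci tensor: the sum over a basis `bᵢ` of
`Ric(bᵢ, bⁱ)`, where `bⁱ` is the `i`-th dual basis covector with its index raised by `G y`. -/
def scalarCurvature (G : E → E →L[ℝ] E →L[ℝ] ℝ) (y : E) : ℝ :=
  ∑ i, ricci G y (Module.finBasis ℝ E i)
    ((G y).inverse (LinearMap.toContinuousLinearMap ((Module.finBasis ℝ E).coord i)))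

/-- The Hessian `∂_u ∂_v φ - dφ(Γ(u, v))`. -/
def hessian (G : E → E →L[ℝ] E →L[ℝ] ℝ) (φ : E → ℝ) (y u v : E) : ℝ :=
  fderiv ℝ (fderiv ℝ φ) y u v - fderiv ℝ φ y (christoffel G y u v)

end Coord

/-! ### Lorentzian manifolds -/

/-- A smooth Lorentzian metric, of signature `(+, …, +, -)`: in every tangent space there is a
timelike vector on whose orthogonal complement the form is positive definite. -/
structure LorentzianMetric (E : Type*) [NormedAddCommGroup E] [NormedSpace ℝ E]
    (M : Type*) [TopologicalSpace M] [ChartedSpace E M] [IsManifold 𝓘(ℝ, E) ∞ M] where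
  val (p : M) : TangentSpace 𝓘(ℝ, E) p →L[ℝ] TangentSpace 𝓘(ℝ, E) p →L[ℝ] ℝ
  symm (p : M) (u v : TangentSpace 𝓘(ℝ, E) p) : val p u v = val p v u
  signature (p : M) : ∃ v : TangentSpace 𝓘(ℝ, E) p, val p v v < 0 ∧
    ∀ u : TangentSpace 𝓘(ℝ, E) p, val p v u = 0 → u ≠ 0 → 0 < val p u u
  contMDiff : ContMDiff 𝓘(ℝ, E) (𝓘(ℝ, E).prod 𝓘(ℝ, E →L[ℝ] E →L[ℝ] ℝ)) ∞
    (fun p => Bundle.TotalSpace.mk' (E →L[ℝ] E →L[ℝ] ℝ)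
      (E := fun p : M => TangentSpace 𝓘(ℝ, E) p →L[ℝ] TangentSpace 𝓘(ℝ, E) p →L[ℝ] ℝ)
      p (val p))

namespace LorentzianMetric

variable {E : Type*} [NormedAddCommGroup E] [NormedSpace ℝ E]
  {M : Type*} [TopologicalSpace M] [ChartedSpace E M] [IsManifold 𝓘(ℝ, E) ∞ M]
  (g : LorentzianMetric E M)

theorem val_injective (p : M) : Function.Injective (g.val p) := by
  refine (injective_iff_map_eq_zero _).2 fun u hu => ?_
  obtain ⟨v, hv, hpos⟩ := g.signature p
  by_contra hne
  have h1 : g.val p v u = 0 := by rw [g.symm, hu]; rfl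
  have h2 := hpos u h1 hne
  rw [hu] at h2
  exact lt_irrefl _ h2

/-- The metric in the chart `e`, that is, its pullback under `e⁻¹`. -/
def inChart (e : OpenPartialHomeomorph M E) (y : E) : E →L[ℝ] E →L[ℝ] ℝ :=
  ContinuousLinearMap.bilinearComp (E := E) (F := E) (E' := E) (F' := E)
    (g.val (e.symm y))
    (mfderiv 𝓘(ℝ, E) 𝓘(ℝ, E) e.symm y) (mfderiv 𝓘(ℝ, E) 𝓘(ℝ, E) e.symm y)

theorem inChart_apply (e : OpenPartialHomeomorph M E) (y u v : E) :
    g.inChart e y u v = g.val (e.symm y)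
      (mfderiv 𝓘(ℝ, E) 𝓘(ℝ, E) e.symm y u) (mfderiv 𝓘(ℝ, E) 𝓘(ℝ, E) e.symm y v) :=
  rfl

variable [FiniteDimensional ℝ E]

/-- The Ricci tensor at `p` on tangent vectors, computed in the chart `e` around `p`.
(Its value does not depend on the chart; the same holds for the next two definitions.) -/
def ricci (e : OpenPartialHomeomorph M E) (p : M) (u v : TangentSpace 𝓘(ℝ, E) p) : ℝ :=
  Coord.ricci (g.inChart e) (e p)
    (mfderiv 𝓘(ℝ, E) 𝓘(ℝ, E) e p u) (mfderiv 𝓘(ℝ, E) 𝓘(ℝ, E) e p v)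

/-- The scalar curvature at `p`, computed in the chart `e` around `p`. -/
def scalarCurvature (e : OpenPartialHomeomorph M E) (p : M) : ℝ :=
  Coord.scalarCurvature (g.inChart e) (e p)

/-- The Hessian of `f` at `p`, computed in the chart `e` around `p`. -/
def hessian (f : M → ℝ) (e : OpenPartialHomeomorph M E) (p : M)
    (u v : TangentSpace 𝓘(ℝ, E) p) : ℝ :=
  Coord.hessian (g.inChart e) (f ∘ e.symm) (e p)
    (mfderiv 𝓘(ℝ, E) 𝓘(ℝ, E) e p u) (mfderiv 𝓘(ℝ, E) 𝓘(ℝ, E) e p v)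

/-- The differential of a real function at `p`, as a covector. -/
def differential (f : M → ℝ) (p : M) : TangentSpace 𝓘(ℝ, E) p →L[ℝ] ℝ :=
  mfderiv 𝓘(ℝ, E) 𝓘(ℝ, ℝ) f p

/-- The gradient `Df`: the vector field with `g(Df, v) = df(v)` (see `gradient_spec`). -/
def gradient (f : M → ℝ) (p : M) : TangentSpace 𝓘(ℝ, E) p :=
  (g.val p).inverse (differential f p)

/-- `ρ` is an eigenvector field of the Ricci tensor with eigenvalue function `ξ`:
`Ric(u, ρ) = ξ g(u, ρ)`, in every chart of the smooth structure. -/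
def IsRicciEigenfield (ρ : (p : M) → TangentSpace 𝓘(ℝ, E) p) (ξ : M → ℝ) : Prop :=
  ∀ e ∈ IsManifold.maximalAtlas 𝓘(ℝ, E) ∞ M, ∀ p ∈ e.source, ∀ u : TangentSpace 𝓘(ℝ, E) p,
    g.ricci e p u (ρ p) = ξ p * g.val p u (ρ p)

/-- `(g, f)` is a gradient `τ`-Einstein soliton with constants `lam`, `τ`: `f` is smooth and
`Hess f + Ric = (lam + τ r) g`, in every chart of the smooth structure. -/
structure IsGradientTauEinsteinSoliton (f : M → ℝ) (lam τ : ℝ) : Prop where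
  contMDiff : ContMDiff 𝓘(ℝ, E) 𝓘(ℝ, ℝ) ∞ f
  equation : ∀ e ∈ IsManifold.maximalAtlas 𝓘(ℝ, E) ∞ M, ∀ p ∈ e.source,
    ∀ u v : TangentSpace 𝓘(ℝ, E) p,
      g.hessian f e p u v + g.ricci e p u v =
        (lam + τ * g.scalarCurvature e p) * g.val p u v

end LorentzianMetric

/-! ### Generalized Robertson-Walker spacetimes -/

/-- A presentation of the Lorentzian manifold `(M, g)` as a generalized Robertson-Walker
spacetime `-J ×_{a²} N`: an open interval `J`, a Riemannian metric `h` on the manifold `N`,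
a smooth positive warping function `a` on `J`, and a diffeomorphism `Φ : J × N → M` with
`Φ^* g = -dt² + a(t)² h`. -/
structure GRWPresentation {E : Type*} [NormedAddCommGroup E] [NormedSpace ℝ E]
    {M : Type*} [TopologicalSpace M] [ChartedSpace E M] [IsManifold 𝓘(ℝ, E) ∞ M]
    (g : LorentzianMetric E M)
    (F : Type*) [NormedAddCommGroup F] [NormedSpace ℝ F]
    (N : Type*) [TopologicalSpace N] [ChartedSpace F N] [IsManifold 𝓘(ℝ, F) ∞ N] where
  J : TopologicalSpace.Opens ℝ
  ordConnected : (J : Set ℝ).OrdConnected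
  a : ℝ → ℝ
  a_contDiffOn : ContDiffOn ℝ ∞ a J
  a_pos : ∀ t ∈ J, 0 < a t
  h : Bundle.ContMDiffRiemannianMetric 𝓘(ℝ, F) ∞ F (fun x : N => TangentSpace 𝓘(ℝ, F) x)
  Φ : Diffeomorph (𝓘(ℝ, ℝ).prod 𝓘(ℝ, F)) 𝓘(ℝ, E) (J × N) M ∞
  metric_eq : ∀ (t : J) (x : N) (s s' : ℝ) (u u' : TangentSpace 𝓘(ℝ, F) x),
    g.val (Φ (t, x))
      (mfderiv (𝓘(ℝ, ℝ).prod 𝓘(ℝ, F)) 𝓘(ℝ, E) Φ (t, x) (s, u))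
      (mfderiv (𝓘(ℝ, ℝ).prod 𝓘(ℝ, F)) 𝓘(ℝ, E) Φ (t, x) (s', u')) =
    -(s * s') + (a t) ^ 2 * h.inner x u u'

namespace GRWPresentation

variable {E : Type*} [NormedAddCommGroup E] [NormedSpace ℝ E]
  {M : Type*} [TopologicalSpace M] [ChartedSpace E M] [IsManifold 𝓘(ℝ, E) ∞ M]
  {g : LorentzianMetric E M}
  {F : Type*} [NormedAddCommGroup F] [NormedSpace ℝ F]
  {N : Type*} [TopologicalSpace N] [ChartedSpace F N] [IsManifold 𝓘(ℝ, F) ∞ N]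
  (P : GRWPresentation g F N)

/-- The unit timelike vector field `ρ = ∂_t` of a GRW spacetime (transported to `M` by `Φ`). -/
def timeField (p : M) : TangentSpace 𝓘(ℝ, E) p :=
  (P.Φ.apply_symm_apply p) ▸
    (mfderiv (𝓘(ℝ, ℝ).prod 𝓘(ℝ, F)) 𝓘(ℝ, E) P.Φ (P.Φ.symm p) ((1 : ℝ), (0 : F)) :
      TangentSpace 𝓘(ℝ, E) (P.Φ (P.Φ.symm p)))

theorem timeField_apply (q : P.J × N) :
    P.timeField (P.Φ q) =
      mfderiv (𝓘(ℝ, ℝ).prod 𝓘(ℝ, F)) 𝓘(ℝ, E) P.Φ q ((1 : ℝ), (0 : F)) := by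
  have key : ∀ (q' : P.J × N) (hq : P.Φ q' = P.Φ q), q' = q →
      (hq ▸ (mfderiv (𝓘(ℝ, ℝ).prod 𝓘(ℝ, F)) 𝓘(ℝ, E) P.Φ q' ((1 : ℝ), (0 : F)) :
        TangentSpace 𝓘(ℝ, E) (P.Φ q')) : TangentSpace 𝓘(ℝ, E) (P.Φ q)) =
      mfderiv (𝓘(ℝ, ℝ).prod 𝓘(ℝ, F)) 𝓘(ℝ, E) P.Φ q ((1 : ℝ), (0 : F)) := by
    rintro q' hq rfl
    rfl
  exact key _ _ (P.Φ.symm_apply_apply q)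

theorem timeField_unit (p : M) : g.val p (P.timeField p) (P.timeField p) = -1 := by
  obtain ⟨⟨t, x⟩, hq⟩ := P.Φ.surjective p
  have hq' : P.Φ (t, x) = p := hq
  subst hq'
  rw [timeField_apply]
  exact (P.metric_eq t x 1 1 0 0).trans (by simp)

end GRWPresentation

namespace LorentzianMetric

variable {E : Type*} [NormedAddCommGroup E] [NormedSpace ℝ E] [FiniteDimensional ℝ E]
  {M : Type*} [TopologicalSpace M] [ChartedSpace E M] [IsManifold 𝓘(ℝ, E) ∞ M]
  (g : LorentzianMetric E M)

theorem gradient_spec (f : M → ℝ) (p : M) (v : TangentSpace 𝓘(ℝ, E) p) :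
    g.val p (g.gradient f p) v = differential f p v := by
  let A : E →L[ℝ] E →L[ℝ] ℝ := g.val p
  have hinj : Function.Injective A := g.val_injective p
  have hfr : Module.finrank ℝ E = Module.finrank ℝ (E →L[ℝ] ℝ) := by
    rw [← (LinearMap.toContinuousLinearMap (𝕜 := ℝ) (E := E) (F' := ℝ)).finrank_eq]
    exact (Subspace.dual_finrank_eq (K := ℝ) (V := E)).symm
  let L : E ≃L[ℝ] (E →L[ℝ] ℝ) :=
    (LinearEquiv.ofInjectiveOfFinrankEq (A : E →ₗ[ℝ] E →L[ℝ] ℝ) hinj hfr).toContinuousLinearEquiv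
  have hL : (L : E →L[ℝ] E →L[ℝ] ℝ) = A := by ext; rfl
  have h2 : ∀ α : E →L[ℝ] ℝ, A (A.inverse α) = α := by
    intro α
    rw [← hL, ContinuousLinearMap.inverse_equiv]
    simp
  exact congrArg (fun α : E →L[ℝ] ℝ => α v) (h2 (differential f p))

end LorentzianMetric

end

/-! Write n = dim M, g = -dt² + a²h, and let Ric* and r* be the Ricci tensor and scalar curvature of
the fibre metric h. The warped product formulas give ξ = (n-1)a''/a, so the hypothesis on ξ provides
a time t₁ with a''(t₁) ≠ 0 (`exists_deriv_deriv_ne_zero`). It remains to see that df kills every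
spatial vector.

The mixed component of the soliton equation is a linear ODE along the time lines; its solution says
that the spatial part of df is aθ with θ independent of time (`fderiv_φ_eq`). The spatial component
then reads a∇θ + Ric* = Ψh, where ∇θ, Ric* and h are independent of time (`hessθ_add_ricci`). As a
takes two different values, Ric* = r*/(n-1) h and ∇θ = ψh (`ricci_base_eq`, `hessθ_eq`). The field V
dual to θ thus satisfies ∇V = ψ id, and the Ricci identity gives Ric*(·, V) = -(n-2)dψ on spatial
vectors (`ricci_V`).

The time component gives τr* = (function of t) - a²f_tt, and the spatial differential of f_tt is
a''θ. So θ = 0 wherever a'' ≠ 0 and τr* is locally a function of t alone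
(`θ_eq_zero_of_spatialScalar`). For τ = 0 this applies at once. For τ ≠ 0, eliminating r* from ψ
shows that dψ = e(t)θ on spatial vectors; wherever θ(u) ≠ 0 the Ricci identity then forces r* =
-(n-1)(n-2)e(t), again a function of t, a contradiction (`θ_eq_zero`). Hence θ vanishes at time t₁,
and therefore at all times.

The fibre geometry is read off from the product metric -dt² + h, so all computations take place on
the single space E. -/

noncomputable section

set_option maxSynthPendingDepth 3
set_option linter.unusedSectionVars false

open Coord Filter Topology

/-! ### Coordinate geometry: Christoffel symbols, curvature and their locality. -/

namespace Coord

variable {E : Type*} [NormedAddCommGroup E] [NormedSpace ℝ E] [FiniteDimensional ℝ E]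

theorem minSmoothness_two_le : minSmoothness ℝ 2 ≤ ∞ := by
  rw [minSmoothness_of_isRCLikeNormedField]
  exact WithTop.coe_le_coe.2 (le_top : (2 : ℕ∞) ≤ ⊤)

/-- The trace of a rank-one map. All contractions of the curvature below reduce to this one and to
the trace of a projection. -/
theorem sum_coord_smul (A : E →L[ℝ] ℝ) (x : E) :
    ∑ i, (Module.finBasis ℝ E).coord i (A (Module.finBasis ℝ E i) • x) = A x := by
  conv_rhs => rw [← (Module.finBasis ℝ E).sum_repr x]
  rw [map_sum]
  simp [mul_comm]

theorem sum_coord_basis :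
    ∑ i, (Module.finBasis ℝ E).coord i (Module.finBasis ℝ E i) = Module.finrank ℝ E := by
  simp

theorem isInvertible_of_injective {A : E →L[ℝ] E →L[ℝ] ℝ} (hA : Function.Injective A) :
    A.IsInvertible := by
  have hfr : Module.finrank ℝ E = Module.finrank ℝ (E →L[ℝ] ℝ) := by
    rw [← (LinearMap.toContinuousLinearMap (𝕜 := ℝ) (E := E) (F' := ℝ)).finrank_eq]
    exact (Subspace.dual_finrank_eq (K := ℝ) (V := E)).symm
  exact ⟨(LinearEquiv.ofInjectiveOfFinrankEq (A : E →ₗ[ℝ] E →L[ℝ] ℝ) hA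
    hfr).toContinuousLinearEquiv, by ext; rfl⟩

theorem inverse_eq_of_apply_eq {A : E →L[ℝ] E →L[ℝ] ℝ} (hA : Function.Injective A)
    {α : E →L[ℝ] ℝ} {x : E} (h : ∀ z, A x z = α z) : A.inverse α = x := by
  have : α = A x := by ext z; exact (h z).symm
  rw [this, (isInvertible_of_injective hA).inverse_apply_self]

theorem apply_inverse {A : E →L[ℝ] E →L[ℝ] ℝ} (hA : Function.Injective A)
    (α : E →L[ℝ] ℝ) (z : E) : A (A.inverse α) z = α z := by
  rw [(isInvertible_of_injective hA).self_apply_inverse]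

variable {G : E → E →L[ℝ] E →L[ℝ] ℝ} {y : E}

theorem apply_christoffel (hG : Function.Injective (G y)) (u v z : E) :
    G y (christoffel G y u v) z = 1 / 2 *
      (fderiv ℝ G y u v z + fderiv ℝ G y v u z - fderiv ℝ G y z u v) := by
  rw [christoffel, apply_inverse hG]
  simp

theorem christoffel_eq_of_apply_eq (hG : Function.Injective (G y)) {u v x : E}
    (h : ∀ z, G y x z = 1 / 2 *
      (fderiv ℝ G y u v z + fderiv ℝ G y v u z - fderiv ℝ G y z u v)) :
    christoffel G y u v = x :=
  inverse_eq_of_apply_eq hG fun z => by rw [h]; simp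

/-- The Christoffel symbols as a continuous bilinear map. -/
def christoffelL (G : E → E →L[ℝ] E →L[ℝ] ℝ) (y : E) : E →L[ℝ] E →L[ℝ] E :=
  (ContinuousLinearMap.compL ℝ E (E →L[ℝ] ℝ) E (G y).inverse).comp
    ((1 / 2 : ℝ) • (fderiv ℝ G y + (fderiv ℝ G y).flip
      - ((ContinuousLinearMap.flipₗᵢ ℝ E E ℝ).toContinuousLinearEquiv : (E →L[ℝ] E →L[ℝ] ℝ) →L[ℝ] _).comp
        (fderiv ℝ G y).flip))

theorem christoffelL_apply (u v : E) : christoffelL G y u v = christoffel G y u v := by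
  simp only [christoffelL, christoffel]
  rfl

theorem contDiffAt_christoffelL (hG : ContDiffAt ℝ ∞ G y) (hinj : Function.Injective (G y)) :
    ContDiffAt ℝ ∞ (christoffelL G) y := by
  have hfd : ContDiffAt ℝ ∞ (fderiv ℝ G) y := hG.fderiv_right (by simp)
  have hflip : ContDiffAt ℝ ∞ (fun y => (fderiv ℝ G y).flip) y :=
    (ContinuousLinearMap.flipₗᵢ ℝ E E (E →L[ℝ] ℝ)).toContinuousLinearEquiv.contDiff.contDiffAt.comp
      y hfd
  have hinv : ContDiffAt ℝ ∞ (fun y => (G y).inverse) y :=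
    ContDiffAt.comp y ((isInvertible_of_injective hinj).contDiffAt_map_inverse) hG
  unfold christoffelL
  refine ContDiffAt.clm_comp ?_ ?_
  · exact (ContinuousLinearMap.compL ℝ E (E →L[ℝ] ℝ) E).contDiff.contDiffAt.comp y hinv
  · refine ContDiffAt.const_smul (1 / 2 : ℝ) ((hfd.add hflip).sub ?_)
    exact contDiffAt_const.clm_comp hflip

/-- With the symbols bundled as a bilinear map, one derivative serves all arguments, and a closed
formula for them valid only near `y` is enough. -/
theorem riemann_eq {Γ : E → E →L[ℝ] E →L[ℝ] E} (hΓ : DifferentiableAt ℝ Γ y)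
    (h : ∀ᶠ z in 𝓝 y, ∀ u v, christoffel G z u v = Γ z u v) (u v w : E) :
    riemann G y u v w = fderiv ℝ Γ y u v w - fderiv ℝ Γ y v u w
      + Γ y u (Γ y v w) - Γ y v (Γ y u w) := by
  have key : ∀ v w u, fderiv ℝ (fun z => christoffel G z v w) y u = fderiv ℝ Γ y u v w := by
    intro v w u
    have h1 : (fun z => christoffel G z v w) =ᶠ[𝓝 y] fun z => Γ z v w := h.mono fun z hz => hz v w
    rw [h1.fderiv_eq, fderiv_clm_apply (by fun_prop) (by fun_prop),
      fderiv_clm_apply (by fun_prop) (by fun_prop)]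
    simp
  simp only [riemann, key, h.self_of_nhds]

/-- Locality, needed because the metric of a chart agrees with the model warped product only on an
open set. -/
theorem christoffel_congr {G' : E → E →L[ℝ] E →L[ℝ] ℝ} (h : G =ᶠ[𝓝 y] G') :
    christoffel G y = christoffel G' y := by
  ext u v
  simp only [christoffel, h.fderiv_eq, h.self_of_nhds]

theorem riemann_congr {G' : E → E →L[ℝ] E →L[ℝ] ℝ} (h : G =ᶠ[𝓝 y] G') :
    riemann G y = riemann G' y := by
  have h1 : ∀ᶠ z in 𝓝 y, christoffel G z = christoffel G' z :=
    h.eventuallyEq_nhds.mono fun z hz => christoffel_congr hz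
  have key : ∀ v w, fderiv ℝ (fun z => christoffel G z v w) y =
      fderiv ℝ (fun z => christoffel G' z v w) y := fun v w =>
    Filter.EventuallyEq.fderiv_eq (h1.mono fun z hz => by simp only [hz])
  ext u v w
  simp only [riemann, key, h1.self_of_nhds]

theorem ricci_congr {G' : E → E →L[ℝ] E →L[ℝ] ℝ} (h : G =ᶠ[𝓝 y] G') :
    ricci G y = ricci G' y := by
  ext v w
  simp only [ricci, riemann_congr h]

theorem scalarCurvature_congr {G' : E → E →L[ℝ] E →L[ℝ] ℝ} (h : G =ᶠ[𝓝 y] G') :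
    scalarCurvature G y = scalarCurvature G' y := by
  simp only [scalarCurvature, ricci_congr h, h.self_of_nhds]

theorem hessian_congr {G' : E → E →L[ℝ] E →L[ℝ] ℝ} (h : G =ᶠ[𝓝 y] G') (φ : E → ℝ) :
    hessian G φ y = hessian G' φ y := by
  ext u v
  simp only [hessian, christoffel_congr h]

end Coord

/-! ### Static splittings and the connection of a warped product. -/

/-- A splitting of the vector space `E` into a time line `ℝ r₀` and its complement `ker T`, with a
time-independent family `H` of symmetric forms with kernel `ℝ r₀`, smooth on the cylinder `W`. -/
structure StaticSplitting (E : Type*) [NormedAddCommGroup E] [NormedSpace ℝ E] where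
  T : E →L[ℝ] ℝ
  r₀ : E
  T_r₀ : T r₀ = 1
  H : E → E →L[ℝ] E →L[ℝ] ℝ
  W : Set E
  isOpen_W : IsOpen W
  add_mem : ∀ y ∈ W, ∀ s : ℝ, y + s • r₀ ∈ W
  H_symm : ∀ y u v, H y u v = H y v u
  H_r₀ : ∀ y u, H y u r₀ = 0
  H_add : ∀ y (s : ℝ), H (y + s • r₀) = H y
  H_pos : ∀ y ∈ W, ∀ u, T u = 0 → u ≠ 0 → 0 < H y u u
  contDiffOn_H : ContDiffOn ℝ ∞ H W

namespace StaticSplitting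

variable {E : Type*} [NormedAddCommGroup E] [NormedSpace ℝ E] (S : StaticSplitting E)

theorem H_r₀_left (y u : E) : S.H y S.r₀ u = 0 := by rw [S.H_symm, S.H_r₀]

/-- The projection to `ker T` along `r₀`. -/
def proj : E →L[ℝ] E := ContinuousLinearMap.id ℝ E - S.T.smulRight S.r₀

theorem proj_apply (u : E) : S.proj u = u - S.T u • S.r₀ := rfl

theorem T_proj (u : E) : S.T (S.proj u) = 0 := by simp [proj_apply, S.T_r₀]

theorem proj_r₀ : S.proj S.r₀ = 0 := by simp [proj_apply, S.T_r₀]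

theorem proj_of_T_eq_zero {u : E} (h : S.T u = 0) : S.proj u = u := by simp [proj_apply, h]

theorem H_proj (y u v : E) : S.H y u (S.proj v) = S.H y u v := by
  simp [proj_apply, S.H_r₀]

theorem H_proj_left (y u v : E) : S.H y (S.proj u) v = S.H y u v := by
  simp [proj_apply, S.H_r₀_left]

/-- The warped product metric `-dt² + a(t)² H`. -/
def metric (a : ℝ → ℝ) (y : E) : E →L[ℝ] E →L[ℝ] ℝ :=
  -(S.T.smulRight S.T) + a (S.T y) ^ 2 • S.H y

theorem metric_apply (a : ℝ → ℝ) (y u v : E) :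
    S.metric a y u v = -(S.T u * S.T v) + a (S.T y) ^ 2 * S.H y u v := by
  simp [metric]

/-- The product metric `-dt² + H`. -/
def base : E → E →L[ℝ] E →L[ℝ] ℝ := S.metric fun _ => 1

theorem base_apply (y u v : E) : S.base y u v = -(S.T u * S.T v) + S.H y u v := by
  simp [base, metric_apply]

theorem base_add (y : E) (s : ℝ) : S.base (y + s • S.r₀) = S.base y := by
  ext u v; rw [base_apply, base_apply, S.H_add]

/-- Pairing a null vector with `r₀` shows that it is spatial, where `H` is positive definite. -/
theorem metric_injective {a : ℝ → ℝ} {y : E} (hy : y ∈ S.W) (ha : a (S.T y) ≠ 0) :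
    Function.Injective (S.metric a y) := by
  refine (injective_iff_map_eq_zero _).2 fun u hu => ?_
  have h1 : S.T u = 0 := by
    have := congrArg (fun l : E →L[ℝ] ℝ => l S.r₀) hu
    simpa [metric_apply, S.H_r₀, S.T_r₀] using this
  by_contra hne
  have h2 := congrArg (fun l : E →L[ℝ] ℝ => l u) hu
  have h3 := S.H_pos y hy u h1 hne
  simp [metric_apply, h1, ha, h3.ne'] at h2

theorem base_injective {y : E} (hy : y ∈ S.W) : Function.Injective (S.base y) :=
  S.metric_injective hy one_ne_zero

theorem contDiffAt_H {y : E} (hy : y ∈ S.W) : ContDiffAt ℝ ∞ S.H y :=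
  S.contDiffOn_H.contDiffAt (S.isOpen_W.mem_nhds hy)

theorem differentiableAt_H {y : E} (hy : y ∈ S.W) : DifferentiableAt ℝ S.H y :=
  (S.contDiffAt_H hy).differentiableAt (by simp)

theorem contDiffAt_metric {a : ℝ → ℝ} {y : E} (hy : y ∈ S.W) (ha : ContDiffAt ℝ ∞ a (S.T y)) :
    ContDiffAt ℝ ∞ (S.metric a) y := by
  have h1 : ContDiffAt ℝ ∞ (fun y => a (S.T y)) y :=
    ContDiffAt.comp y ha S.T.contDiff.contDiffAt
  exact contDiffAt_const.add ((h1.pow 2).smul (S.contDiffAt_H hy))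

theorem fderiv_metric {a : ℝ → ℝ} {y : E} (hy : y ∈ S.W) (ha : DifferentiableAt ℝ a (S.T y))
    (u v w : E) :
    fderiv ℝ (S.metric a) y u v w = 2 * a (S.T y) * deriv a (S.T y) * S.T u * S.H y v w
      + a (S.T y) ^ 2 * fderiv ℝ S.H y u v w := by
  have h1 : HasFDerivAt (fun y => a (S.T y)) (deriv a (S.T y) • S.T) y :=
    ha.hasDerivAt.comp_hasFDerivAt y S.T.hasFDerivAt
  have h2 := ((h1.pow 2).smul (S.differentiableAt_H hy).hasFDerivAt).const_add
    (-(S.T.smulRight S.T))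
  have h3 : HasFDerivAt (S.metric a) _ y := h2
  rw [h3.fderiv]
  simp
  ring

theorem fderiv_base {y : E} (hy : y ∈ S.W) (u v w : E) :
    fderiv ℝ S.base y u v w = fderiv ℝ S.H y u v w := by
  rw [base, S.fderiv_metric hy (differentiableAt_const _)]
  simp

theorem fderiv_H_apply {y : E} (hy : y ∈ S.W) (u v w : E) :
    fderiv ℝ S.H y u v w = fderiv ℝ (fun z => S.H z v w) y u := by
  have h := S.differentiableAt_H hy
  rw [fderiv_clm_apply (by fun_prop) (by fun_prop), fderiv_clm_apply (by fun_prop) (by fun_prop)]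
  simp

theorem fderiv_H_symm {y : E} (hy : y ∈ S.W) (u v w : E) :
    fderiv ℝ S.H y u v w = fderiv ℝ S.H y u w v := by
  rw [S.fderiv_H_apply hy, S.fderiv_H_apply hy]
  simp only [fun z => S.H_symm z v w]

theorem fderiv_H_r₀ {y : E} (hy : y ∈ S.W) (u v : E) : fderiv ℝ S.H y u v S.r₀ = 0 := by
  rw [S.fderiv_H_apply hy]
  simp [S.H_r₀]

theorem fderiv_H_r₀' {y : E} (hy : y ∈ S.W) (u v : E) : fderiv ℝ S.H y u S.r₀ v = 0 := by
  rw [S.fderiv_H_symm hy, S.fderiv_H_r₀ hy]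

/-- A function that is constant along the time lines has vanishing time derivative. -/
theorem fderiv_apply_r₀_of_add {A : Type*} [NormedAddCommGroup A] [NormedSpace ℝ A] {Q : E → A}
    {y : E} (hQ : ∀ s : ℝ, Q (y + s • S.r₀) = Q y) (hd : DifferentiableAt ℝ Q y) :
    fderiv ℝ Q y S.r₀ = 0 := by
  rw [← hd.lineDeriv_eq_fderiv]
  simp [lineDeriv, hQ]

theorem fderiv_H_time {y : E} (hy : y ∈ S.W) : fderiv ℝ S.H y S.r₀ = 0 :=
  S.fderiv_apply_r₀_of_add (S.H_add y) (S.differentiableAt_H hy)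

variable [FiniteDimensional ℝ E]

/-- The Christoffel symbols of the product metric. -/
def Γ : E → E →L[ℝ] E →L[ℝ] E := christoffelL S.base

theorem contDiffAt_Γ {y : E} (hy : y ∈ S.W) : ContDiffAt ℝ ∞ S.Γ y :=
  contDiffAt_christoffelL (S.contDiffAt_metric hy contDiffAt_const) (S.base_injective hy)

theorem differentiableAt_Γ {y : E} (hy : y ∈ S.W) : DifferentiableAt ℝ S.Γ y :=
  (S.contDiffAt_Γ hy).differentiableAt (by simp)

theorem fderiv_base_add (y : E) (s : ℝ) :
    fderiv ℝ S.base (y + s • S.r₀) = fderiv ℝ S.base y := by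
  rw [← fderiv_comp_add_right]
  simp only [S.base_add]

theorem Γ_add (y : E) (s : ℝ) : S.Γ (y + s • S.r₀) = S.Γ y := by
  simp only [Γ, christoffelL, S.base_add, S.fderiv_base_add]

theorem base_Γ {y : E} (hy : y ∈ S.W) (u v z : E) :
    S.base y (S.Γ y u v) z = 1 / 2 *
      (fderiv ℝ S.H y u v z + fderiv ℝ S.H y v u z - fderiv ℝ S.H y z u v) := by
  rw [Γ, christoffelL_apply, apply_christoffel (S.base_injective hy)]
  simp only [S.fderiv_base hy]

theorem eq_of_base {y : E} (hy : y ∈ S.W) {u v : E} (h : ∀ z, S.base y u z = S.base y v z) :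
    u = v :=
  S.base_injective hy (by ext z; exact h z)

theorem Γ_symm {y : E} (hy : y ∈ S.W) (u v : E) : S.Γ y u v = S.Γ y v u := by
  refine S.eq_of_base hy fun z => ?_
  rw [S.base_Γ hy, S.base_Γ hy, S.fderiv_H_symm hy z u v]
  ring

/-- The time direction is parallel for the product metric. Together with `T_Γ` this makes the
product connection, restricted to `ker T`, the Levi-Civita connection of the fibre. -/
theorem Γ_r₀ {y : E} (hy : y ∈ S.W) (u : E) : S.Γ y u S.r₀ = 0 := by
  refine S.eq_of_base hy fun z => ?_
  rw [S.base_Γ hy, S.fderiv_H_time hy, S.fderiv_H_r₀ hy, S.fderiv_H_r₀' hy]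
  simp

theorem Γ_r₀_left {y : E} (hy : y ∈ S.W) (u : E) : S.Γ y S.r₀ u = 0 := by
  rw [S.Γ_symm hy, S.Γ_r₀ hy]

theorem T_Γ {y : E} (hy : y ∈ S.W) (u v : E) : S.T (S.Γ y u v) = 0 := by
  have := S.base_Γ hy u v S.r₀
  simpa [S.fderiv_H_r₀ hy, S.fderiv_H_time hy, S.base_apply, S.T_r₀, S.H_r₀] using this

theorem Γ_proj {y : E} (hy : y ∈ S.W) (u v : E) : S.Γ y u (S.proj v) = S.Γ y u v := by
  simp [proj_apply, S.Γ_r₀ hy]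

theorem proj_Γ {y : E} (hy : y ∈ S.W) (u v : E) : S.proj (S.Γ y u v) = S.Γ y u v :=
  S.proj_of_T_eq_zero (S.T_Γ hy u v)

theorem H_Γ {y : E} (hy : y ∈ S.W) (u v z : E) :
    S.H y (S.Γ y u v) z = 1 / 2 *
      (fderiv ℝ S.H y u v z + fderiv ℝ S.H y v u z - fderiv ℝ S.H y z u v) := by
  rw [← S.base_Γ hy, S.base_apply, S.T_Γ hy]
  simp

/-- The product connection is metric. -/
theorem fderiv_H_eq {y : E} (hy : y ∈ S.W) (u v w : E) :
    fderiv ℝ S.H y u v w = S.H y (S.Γ y u v) w + S.H y v (S.Γ y u w) := by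
  rw [S.H_symm y v, S.H_Γ hy, S.H_Γ hy, S.fderiv_H_symm hy w u v, S.fderiv_H_symm hy u w v,
    S.fderiv_H_symm hy v u w]
  ring

/-- The Christoffel symbols of the warped product. -/
def warpedΓ (a : ℝ → ℝ) (y : E) : E →L[ℝ] E →L[ℝ] E :=
  S.Γ y + (deriv a (S.T y) / a (S.T y)) • (S.T.smulRight S.proj + (S.T.smulRight S.proj).flip)
    + (a (S.T y) * deriv a (S.T y)) •
      (ContinuousLinearMap.compL ℝ E ℝ E (ContinuousLinearMap.toSpanSingleton ℝ S.r₀)).comp (S.H y)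

theorem warpedΓ_apply (a : ℝ → ℝ) (y u v : E) :
    S.warpedΓ a y u v = S.Γ y u v
      + (deriv a (S.T y) / a (S.T y)) • (S.T u • S.proj v + S.T v • S.proj u)
      + (a (S.T y) * deriv a (S.T y) * S.H y u v) • S.r₀ := by
  simp [warpedΓ, smul_smul]

/-- The Koszul formula determines the symbols, so it suffices to verify it for the candidate
`warpedΓ`. -/
theorem christoffel_metric {a : ℝ → ℝ} {y : E} (hy : y ∈ S.W) (ha : a (S.T y) ≠ 0)
    (hd : DifferentiableAt ℝ a (S.T y)) (u v : E) :
    christoffel (S.metric a) y u v = S.warpedΓ a y u v := by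
  refine christoffel_eq_of_apply_eq (S.metric_injective hy ha) fun z => ?_
  simp only [S.fderiv_metric hy hd, warpedΓ_apply, metric_apply, map_add, map_smul, smul_eq_mul,
    add_apply, smul_apply, S.T_Γ hy, S.T_proj, S.T_r₀,
    S.H_proj_left, S.H_Γ hy, S.H_r₀_left]
  field_simp
  ring

end StaticSplitting

/-! ### Curvature of the product metric and spatial traces. -/

namespace StaticSplitting

variable {E : Type*} [NormedAddCommGroup E] [NormedSpace ℝ E] [FiniteDimensional ℝ E]
  (S : StaticSplitting E)

theorem riemann_base {y : E} (hy : y ∈ S.W) (u v w : E) :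
    riemann S.base y u v w = fderiv ℝ S.Γ y u v w - fderiv ℝ S.Γ y v u w
      + S.Γ y u (S.Γ y v w) - S.Γ y v (S.Γ y u w) :=
  riemann_eq (S.differentiableAt_Γ hy)
    (Eventually.of_forall fun _ _ _ => (christoffelL_apply _ _).symm) u v w

theorem fderiv_Γ_apply {y : E} (hy : y ∈ S.W) (u v w : E) :
    fderiv ℝ S.Γ y u v w = fderiv ℝ (fun z => S.Γ z v w) y u := by
  have h := S.differentiableAt_Γ hy
  rw [fderiv_clm_apply (by fun_prop) (by fun_prop), fderiv_clm_apply (by fun_prop) (by fun_prop)]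
  simp

theorem fderiv_Γ_time {y : E} (hy : y ∈ S.W) : fderiv ℝ S.Γ y S.r₀ = 0 :=
  S.fderiv_apply_r₀_of_add (S.Γ_add y) (S.differentiableAt_Γ hy)

theorem fderiv_Γ_r₀ {y : E} (hy : y ∈ S.W) (u v : E) : fderiv ℝ S.Γ y u v S.r₀ = 0 := by
  have h : (fun z => S.Γ z v S.r₀) =ᶠ[𝓝 y] fun _ => 0 := by
    filter_upwards [S.isOpen_W.mem_nhds hy] with z hz using S.Γ_r₀ hz v
  rw [S.fderiv_Γ_apply hy, h.fderiv_eq]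
  simp

theorem fderiv_Γ_r₀_left {y : E} (hy : y ∈ S.W) (u v : E) : fderiv ℝ S.Γ y u S.r₀ v = 0 := by
  have h : (fun z => S.Γ z S.r₀ v) =ᶠ[𝓝 y] fun _ => 0 := by
    filter_upwards [S.isOpen_W.mem_nhds hy] with z hz using S.Γ_r₀_left hz v
  rw [S.fderiv_Γ_apply hy, h.fderiv_eq]
  simp

theorem ricci_base_add_right {y : E} (hy : y ∈ S.W) (v w w' : E) :
    ricci S.base y v (w + w') = ricci S.base y v w + ricci S.base y v w' := by
  simp only [ricci, S.riemann_base hy, ← Finset.sum_add_distrib]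
  refine Finset.sum_congr rfl fun i _ => ?_
  simp only [map_add, map_sub]
  ring

theorem ricci_base_smul_right {y : E} (hy : y ∈ S.W) (v w : E) (c : ℝ) :
    ricci S.base y v (c • w) = c * ricci S.base y v w := by
  simp only [ricci, S.riemann_base hy, Finset.mul_sum]
  refine Finset.sum_congr rfl fun i _ => ?_
  simp only [map_add, map_sub, map_smul, smul_eq_mul]
  ring

theorem ricci_base_add_left {y : E} (hy : y ∈ S.W) (v v' w : E) :
    ricci S.base y (v + v') w = ricci S.base y v w + ricci S.base y v' w := by
  simp only [ricci, S.riemann_base hy, ← Finset.sum_add_distrib]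
  refine Finset.sum_congr rfl fun i _ => ?_
  simp only [map_add, map_sub, add_apply]
  ring

theorem ricci_base_smul_left {y : E} (hy : y ∈ S.W) (v w : E) (c : ℝ) :
    ricci S.base y (c • v) w = c * ricci S.base y v w := by
  simp only [ricci, S.riemann_base hy, Finset.mul_sum]
  refine Finset.sum_congr rfl fun i _ => ?_
  simp only [map_add, map_sub, map_smul, smul_apply, smul_eq_mul]
  ring

theorem ricci_base_r₀ {y : E} (hy : y ∈ S.W) (v : E) : ricci S.base y v S.r₀ = 0 := by
  simp [ricci, S.riemann_base hy, S.Γ_r₀ hy, S.fderiv_Γ_r₀ hy]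

theorem ricci_base_r₀_left {y : E} (hy : y ∈ S.W) (v : E) : ricci S.base y S.r₀ v = 0 := by
  simp [ricci, S.riemann_base hy, S.Γ_r₀_left hy, S.fderiv_Γ_r₀_left hy,
    S.fderiv_Γ_time hy]

theorem ricci_base_proj {y : E} (hy : y ∈ S.W) (v w : E) :
    ricci S.base y v (S.proj w) = ricci S.base y v w := by
  rw [proj_apply, sub_eq_add_neg, ← neg_smul, S.ricci_base_add_right hy, S.ricci_base_smul_right hy,
    S.ricci_base_r₀ hy]
  ring

theorem ricci_base_proj_left {y : E} (hy : y ∈ S.W) (v w : E) :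
    ricci S.base y (S.proj v) w = ricci S.base y v w := by
  rw [proj_apply, sub_eq_add_neg, ← neg_smul, S.ricci_base_add_left hy, S.ricci_base_smul_left hy,
    S.ricci_base_r₀_left hy]
  ring

theorem riemann_base_add (y : E) (s : ℝ) :
    riemann S.base (y + s • S.r₀) = riemann S.base y := by
  have h : ∀ z, christoffel S.base z = fun u v => S.Γ z u v := fun z => by
    ext u v; exact (christoffelL_apply u v).symm
  have key : ∀ v w, fderiv ℝ (fun z => christoffel S.base z v w) (y + s • S.r₀) =
      fderiv ℝ (fun z => christoffel S.base z v w) y := by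
    intro v w
    rw [← fderiv_comp_add_right]
    simp only [h, S.Γ_add]
  ext u v w
  simp only [riemann, key]
  simp only [h, S.Γ_add]

theorem ricci_base_add (y : E) (s : ℝ) : ricci S.base (y + s • S.r₀) = ricci S.base y := by
  ext v w
  simp only [ricci, S.riemann_base_add]

/-- The trace of a projection is its rank, here the dimension of the fibre. -/
theorem sum_coord_proj :
    ∑ i, (Module.finBasis ℝ E).coord i (S.proj (Module.finBasis ℝ E i)) =
      Module.finrank ℝ E - 1 := by
  simp only [proj_apply, map_sub, Finset.sum_sub_distrib, sum_coord_smul, sum_coord_basis, S.T_r₀]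

/-- The raised covector `α`, with its time part removed. -/
def raise (y : E) (α : E →L[ℝ] ℝ) : E := (S.base y).inverse α + α S.r₀ • S.r₀

theorem T_raise {y : E} (hy : y ∈ S.W) (α : E →L[ℝ] ℝ) : S.T (S.raise y α) = 0 := by
  have h := apply_inverse (S.base_injective hy) α S.r₀
  rw [S.base_apply, S.H_r₀, S.T_r₀] at h
  simp only [raise, map_add, map_smul, smul_eq_mul, S.T_r₀]
  linarith

theorem H_raise {y : E} (hy : y ∈ S.W) (α : E →L[ℝ] ℝ) (z : E) :
    S.H y (S.raise y α) z = α (S.proj z) := by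
  have h := apply_inverse (S.base_injective hy) α (S.proj z)
  rw [S.base_apply, S.T_proj, S.H_proj] at h
  simp only [raise, map_add, map_smul, add_apply, smul_apply, S.H_r₀_left]
  simpa using h

/-- Time and space are orthogonal, so indices are raised separately; the warping function enters
only as the factor a⁻² on the spatial part. -/
theorem inverse_metric {a : ℝ → ℝ} {y : E} (hy : y ∈ S.W) (ha : a (S.T y) ≠ 0)
    (α : E →L[ℝ] ℝ) :
    (S.metric a y).inverse α = (-α S.r₀) • S.r₀ + (a (S.T y) ^ 2)⁻¹ • S.raise y α := by
  refine inverse_eq_of_apply_eq (S.metric_injective hy ha) fun z => ?_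
  simp only [metric_apply, map_add, map_smul, add_apply, smul_apply, S.T_r₀, S.T_raise hy,
    S.H_raise hy, S.H_r₀_left, proj_apply, map_sub, smul_eq_mul]
  field_simp
  ring

/-- The scalar curvature of the spatial metric. -/
def spatialScalar (y : E) : ℝ :=
  ∑ i, ricci S.base y (Module.finBasis ℝ E i)
    (S.raise y (LinearMap.toContinuousLinearMap ((Module.finBasis ℝ E).coord i)))

theorem sum_H_raise {y : E} (hy : y ∈ S.W) :
    ∑ i, S.H y (Module.finBasis ℝ E i)
      (S.raise y (LinearMap.toContinuousLinearMap ((Module.finBasis ℝ E).coord i))) =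
      Module.finrank ℝ E - 1 := by
  rw [← S.sum_coord_proj]
  refine Finset.sum_congr rfl fun i _ => ?_
  rw [S.H_symm, S.H_raise hy]
  rfl

theorem spatialScalar_eq {y : E} (hy : y ∈ S.W) {σ : ℝ}
    (h : ∀ u v, S.T u = 0 → S.T v = 0 → ricci S.base y u v = σ * S.H y u v) :
    S.spatialScalar y = (Module.finrank ℝ E - 1) * σ := by
  rw [← S.sum_H_raise hy, Finset.sum_mul]
  refine Finset.sum_congr rfl fun i _ => ?_
  rw [← S.ricci_base_proj_left hy, h _ _ (S.T_proj _) (S.T_raise hy _), S.H_proj_left, mul_comm]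

end StaticSplitting

/-! ### Curvature of the warped product. -/

/-- A static splitting together with a smooth positive warping function on an open set. -/
structure WarpedSplitting (E : Type*) [NormedAddCommGroup E] [NormedSpace ℝ E]
    extends StaticSplitting E where
  J : Set ℝ
  isOpen_J : IsOpen J
  a : ℝ → ℝ
  contDiffOn_a : ContDiffOn ℝ ∞ a J
  a_pos : ∀ t ∈ J, 0 < a t

namespace WarpedSplitting

variable {E : Type*} [NormedAddCommGroup E] [NormedSpace ℝ E] (S : WarpedSplitting E)

/-- The domain of the warped product metric. -/
def U : Set E := S.W ∩ S.T ⁻¹' S.J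

theorem isOpen_U : IsOpen S.U := S.isOpen_W.inter (S.isOpen_J.preimage S.T.continuous)

theorem a_ne {t : ℝ} (ht : t ∈ S.J) : S.a t ≠ 0 := (S.a_pos t ht).ne'

theorem contDiffAt_a {t : ℝ} (ht : t ∈ S.J) : ContDiffAt ℝ ∞ S.a t :=
  S.contDiffOn_a.contDiffAt (S.isOpen_J.mem_nhds ht)

theorem contDiffAt_deriv_a {t : ℝ} (ht : t ∈ S.J) : ContDiffAt ℝ ∞ (deriv S.a) t :=
  ((S.contDiffOn_a.deriv_of_isOpen S.isOpen_J (m := ∞) (by simp)).contDiffAt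
    (S.isOpen_J.mem_nhds ht))

theorem contDiffAt_deriv_deriv_a {t : ℝ} (ht : t ∈ S.J) :
    ContDiffAt ℝ ∞ (deriv (deriv S.a)) t :=
  (ContDiffOn.deriv_of_isOpen (S.contDiffOn_a.deriv_of_isOpen S.isOpen_J (m := ∞) (by simp))
    S.isOpen_J (m := ∞) (by simp)).contDiffAt (S.isOpen_J.mem_nhds ht)

theorem hasDerivAt_a {t : ℝ} (ht : t ∈ S.J) : HasDerivAt S.a (deriv S.a t) t :=
  ((S.contDiffAt_a ht).differentiableAt (by simp)).hasDerivAt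

theorem hasDerivAt_deriv_a {t : ℝ} (ht : t ∈ S.J) :
    HasDerivAt (deriv S.a) (deriv (deriv S.a) t) t :=
  ((S.contDiffAt_deriv_a ht).differentiableAt (by simp)).hasDerivAt

variable [FiniteDimensional ℝ E]

theorem differentiableAt_warpedΓ {y : E} (hy : y ∈ S.U) :
    DifferentiableAt ℝ (S.warpedΓ S.a) y := by
  have h1 := S.differentiableAt_Γ hy.1
  have h2 : DifferentiableAt ℝ (fun y => S.a (S.T y)) y :=
    (S.hasDerivAt_a hy.2).differentiableAt.comp y S.T.differentiableAt
  have h3 : DifferentiableAt ℝ (fun y => deriv S.a (S.T y)) y :=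
    (S.hasDerivAt_deriv_a hy.2).differentiableAt.comp y S.T.differentiableAt
  have h4 := S.differentiableAt_H hy.1
  have h5 : S.a (S.T y) ≠ 0 := S.a_ne hy.2
  unfold StaticSplitting.warpedΓ
  have h6 : DifferentiableAt ℝ (fun y => deriv S.a (S.T y) / S.a (S.T y)) y :=
    ((S.hasDerivAt_deriv_a hy.2).div (S.hasDerivAt_a hy.2) h5).differentiableAt.comp y
      S.T.differentiableAt
  exact (h1.add (h6.smul_const _)).add
    ((h2.fun_mul h3).smul ((differentiableAt_const _).clm_comp h4))

theorem fderiv_warpedΓ {y : E} (hy : y ∈ S.U) (u v w : E) :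
    fderiv ℝ (S.warpedΓ S.a) y u v w = fderiv ℝ S.Γ y u v w
      + ((deriv (deriv S.a) (S.T y) / S.a (S.T y) - (deriv S.a (S.T y) / S.a (S.T y)) ^ 2)
          * S.T u) • (S.T v • S.proj w + S.T w • S.proj v)
      + (((deriv S.a (S.T y) ^ 2 + S.a (S.T y) * deriv (deriv S.a) (S.T y)) * S.T u) * S.H y v w
          + S.a (S.T y) * deriv S.a (S.T y) * fderiv ℝ S.H y u v w) • S.r₀ := by
  have hd := S.differentiableAt_warpedΓ hy
  have h0 : fderiv ℝ (S.warpedΓ S.a) y u v w = fderiv ℝ (fun z => S.warpedΓ S.a z v w) y u := by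
    rw [fderiv_clm_apply (by fun_prop) (by fun_prop),
      fderiv_clm_apply (by fun_prop) (by fun_prop)]
    simp
  have hT : HasFDerivAt (fun y => S.T y) S.T y := S.T.hasFDerivAt
  have h1 : HasFDerivAt (fun z => S.Γ z v w) (fderiv ℝ (fun z => S.Γ z v w) y) y := by
    have := S.differentiableAt_Γ hy.1
    exact DifferentiableAt.hasFDerivAt (by fun_prop)
  have h4 : HasFDerivAt (fun z => S.H z v w) (fderiv ℝ (fun z => S.H z v w) y) y := by
    have := S.differentiableAt_H hy.1
    exact DifferentiableAt.hasFDerivAt (by fun_prop)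
  have h2 := (((S.hasDerivAt_deriv_a hy.2).div (S.hasDerivAt_a hy.2)
    (S.a_ne hy.2)).comp_hasFDerivAt y hT).smul_const (S.T v • S.proj w + S.T w • S.proj v)
  have h3 := ((((S.hasDerivAt_a hy.2).mul (S.hasDerivAt_deriv_a hy.2)).comp_hasFDerivAt y
    hT).mul h4).smul_const S.r₀
  have h5 := (h1.add h2).add h3
  have h6 : HasFDerivAt (fun z => S.warpedΓ S.a z v w) _ y :=
    h5.congr_of_eventuallyEq (Eventually.of_forall fun z => S.warpedΓ_apply S.a z v w)
  rw [h0, h6.fderiv, S.fderiv_Γ_apply hy.1, S.fderiv_H_apply hy.1]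
  have ha : S.a (S.T y) ≠ 0 := S.a_ne hy.2
  simp only [add_apply, smul_apply, ContinuousLinearMap.smulRight_apply, smul_eq_mul,
    Function.comp_apply, Pi.mul_apply]
  congr 2
  · congr 1
    field_simp
  · ring

/-- The warped product metric. -/
def G : E → E →L[ℝ] E →L[ℝ] ℝ := S.metric S.a

theorem christoffel_G {y : E} (hy : y ∈ S.U) (u v : E) :
    christoffel S.G y u v = S.warpedΓ S.a y u v :=
  S.christoffel_metric hy.1 (S.a_ne hy.2) (S.hasDerivAt_a hy.2).differentiableAt u v

theorem riemann_G {y : E} (hy : y ∈ S.U) (u v w : E) :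
    riemann S.G y u v w = riemann S.base y u v w
      + (deriv (deriv S.a) (S.T y) / S.a (S.T y) * S.T w) •
          (S.T u • S.proj v - S.T v • S.proj u)
      + (S.a (S.T y) * deriv (deriv S.a) (S.T y) * (S.T u * S.H y v w - S.T v * S.H y u w)) • S.r₀
      + deriv S.a (S.T y) ^ 2 • (S.H y v w • S.proj u - S.H y u w • S.proj v) := by
  rw [riemann_eq (S.differentiableAt_warpedΓ hy)
    (by filter_upwards [S.isOpen_U.mem_nhds hy] with z hz using S.christoffel_G hz),
    S.riemann_base hy.1, S.fderiv_warpedΓ hy, S.fderiv_warpedΓ hy]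
  have ha : S.a (S.T y) ≠ 0 := S.a_ne hy.2
  have hp : S.a (S.T y) * deriv S.a (S.T y) * (deriv S.a (S.T y) / S.a (S.T y)) =
    deriv S.a (S.T y) ^ 2 := by field_simp
  -- All coefficients are expressed through a², a'/a and a''/a, so that the remaining identity holds
  -- without cancelling any denominator.
  have hr : S.a (S.T y) * deriv (deriv S.a) (S.T y) = S.a (S.T y) ^ 2 *
    (deriv (deriv S.a) (S.T y) / S.a (S.T y)) := by field_simp
  have hs : deriv S.a (S.T y) ^ 2 = S.a (S.T y) ^ 2 *
    (deriv S.a (S.T y) / S.a (S.T y)) ^ 2 := by field_simp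
  have hs' : S.a (S.T y) * deriv S.a (S.T y) = S.a (S.T y) ^ 2 *
    (deriv S.a (S.T y) / S.a (S.T y)) := by field_simp
  simp only [S.warpedΓ_apply, map_add, map_smul, S.T_Γ hy.1, S.T_proj, S.T_r₀, S.Γ_r₀ hy.1,
    S.Γ_proj hy.1, S.proj_Γ hy.1, S.proj_r₀, S.H_proj, S.H_r₀, S.proj_of_T_eq_zero (S.T_proj _),
    S.fderiv_H_eq hy.1, smul_eq_mul, S.Γ_symm hy.1 v u, S.H_symm y v u, S.H_symm y (S.Γ y u v) w, hr, hs, hs']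
  module

end WarpedSplitting

namespace WarpedSplitting

variable {E : Type*} [NormedAddCommGroup E] [NormedSpace ℝ E] [FiniteDimensional ℝ E]
  (S : WarpedSplitting E)

/-- The trace of `riemann_G`: the projection contributes n-1, the rank-one terms contribute
evaluations. On `(r₀, r₀)` only -(n-1)a''/a survives, which identifies the eigenvalue ξ. -/
theorem ricci_G {y : E} (hy : y ∈ S.U) (v w : E) :
    ricci S.G y v w = ricci S.base y v w
      - (Module.finrank ℝ E - 1) * (deriv (deriv S.a) (S.T y) / S.a (S.T y)) * S.T v * S.T w
      + (S.a (S.T y) * deriv (deriv S.a) (S.T y)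
          + (Module.finrank ℝ E - 2) * deriv S.a (S.T y) ^ 2) * S.H y v w := by
  have h1 : ∀ x : E, ∑ i, S.T (Module.finBasis ℝ E i) * (Module.finBasis ℝ E).coord i x =
      S.T x := fun x => by
    simpa only [map_smul, smul_eq_mul] using sum_coord_smul S.T x
  have h2 : ∀ x : E, ∑ i, S.H y (Module.finBasis ℝ E i) w * (Module.finBasis ℝ E).coord i x =
      S.H y x w := fun x => by
    simpa only [map_smul, smul_eq_mul, ContinuousLinearMap.flip_apply] using
      sum_coord_smul ((S.H y).flip w) x
  have h3 := S.sum_coord_proj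
  simp only [ricci, S.riemann_G hy, map_add, map_smul, map_sub, smul_eq_mul,
    Finset.sum_add_distrib, mul_sub, sub_mul, Finset.sum_sub_distrib]
  simp only [mul_assoc, ← Finset.mul_sum, h3]
  simp only [mul_left_comm _ (S.H y v w), ← Finset.mul_sum]
  have h4 := h1 (S.proj v)
  have h5 := h2 (S.proj v)
  have h6 := h1 S.r₀
  have h7 := h2 S.r₀
  rw [S.T_proj] at h4
  rw [S.H_proj_left] at h5
  rw [S.T_r₀] at h6
  rw [S.H_r₀_left] at h7
  simp only [h4, h5, h6, h7]
  ring

theorem scalarCurvature_G {y : E} (hy : y ∈ S.U) :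
    scalarCurvature S.G y =
      (Module.finrank ℝ E - 1) * (deriv (deriv S.a) (S.T y) / S.a (S.T y))
      + (S.spatialScalar y + (Module.finrank ℝ E - 1) * (S.a (S.T y) * deriv (deriv S.a) (S.T y)
          + (Module.finrank ℝ E - 2) * deriv S.a (S.T y) ^ 2)) / S.a (S.T y) ^ 2 := by
  have ha : S.a (S.T y) ≠ 0 := S.a_ne hy.2
  have hinv : ∀ α, (S.G y).inverse α = _ := S.inverse_metric hy.1 ha
  have h1 : ∑ i, S.T (Module.finBasis ℝ E i) * (Module.finBasis ℝ E).coord i S.r₀ = 1 := by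
    rw [← S.T_r₀]
    simpa only [map_smul, smul_eq_mul] using sum_coord_smul S.T S.r₀
  have key : ∀ i, ricci S.G y (Module.finBasis ℝ E i)
      ((S.G y).inverse (LinearMap.toContinuousLinearMap ((Module.finBasis ℝ E).coord i))) =
      (Module.finrank ℝ E - 1) * (deriv (deriv S.a) (S.T y) / S.a (S.T y)) *
        (S.T (Module.finBasis ℝ E i) * (Module.finBasis ℝ E).coord i S.r₀)
      + (S.a (S.T y) ^ 2)⁻¹ * ricci S.base y (Module.finBasis ℝ E i)
        (S.raise y (LinearMap.toContinuousLinearMap ((Module.finBasis ℝ E).coord i)))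
      + (S.a (S.T y) ^ 2)⁻¹ * (S.a (S.T y) * deriv (deriv S.a) (S.T y)
          + (Module.finrank ℝ E - 2) * deriv S.a (S.T y) ^ 2) * S.H y (Module.finBasis ℝ E i)
        (S.raise y (LinearMap.toContinuousLinearMap ((Module.finBasis ℝ E).coord i))) := by
    intro i
    rw [S.ricci_G hy, hinv, S.ricci_base_add_right hy.1, S.ricci_base_smul_right hy.1,
      S.ricci_base_smul_right hy.1, S.ricci_base_r₀ hy.1]
    simp only [map_add, map_smul, S.T_r₀, S.T_raise hy.1, S.H_r₀, smul_eq_mul,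
      LinearMap.coe_toContinuousLinearMap']
    ring
  simp only [scalarCurvature, key, Finset.sum_add_distrib, ← Finset.mul_sum, h1,
    S.sum_H_raise hy.1]
  rw [StaticSplitting.spatialScalar]
  ring

end WarpedSplitting

/-! ### The components of the soliton equation and the time-independent form θ. -/

/-- A warped product metric in coordinates with a gradient `τ`-Einstein soliton. -/
structure SolitonSplitting (E : Type*) [NormedAddCommGroup E] [NormedSpace ℝ E]
    [FiniteDimensional ℝ E] extends WarpedSplitting E where
  ordConnected_J : J.OrdConnected
  φ : E → ℝ
  lam : ℝ
  τ : ℝ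
  contDiffOn_φ : ContDiffOn ℝ ∞ φ toWarpedSplitting.U
  soliton : ∀ y ∈ toWarpedSplitting.U, ∀ u v,
    hessian toWarpedSplitting.G φ y u v + ricci toWarpedSplitting.G y u v =
      (lam + τ * scalarCurvature toWarpedSplitting.G y) * toWarpedSplitting.G y u v

namespace SolitonSplitting

variable {E : Type*} [NormedAddCommGroup E] [NormedSpace ℝ E] [FiniteDimensional ℝ E]
  (S : SolitonSplitting E)

theorem contDiffAt_φ {y : E} (hy : y ∈ S.U) : ContDiffAt ℝ ∞ S.φ y :=
  S.contDiffOn_φ.contDiffAt (S.isOpen_U.mem_nhds hy)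

theorem contDiffAt_fderiv_φ {y : E} (hy : y ∈ S.U) : ContDiffAt ℝ ∞ (fderiv ℝ S.φ) y :=
  (S.contDiffAt_φ hy).fderiv_right (by simp)

theorem contDiffAt_fderiv_fderiv_φ {y : E} (hy : y ∈ S.U) :
    ContDiffAt ℝ ∞ (fderiv ℝ (fderiv ℝ S.φ)) y :=
  (S.contDiffAt_fderiv_φ hy).fderiv_right (by simp)

theorem fderiv_fderiv_symm {y : E} (hy : y ∈ S.U) (u v : E) :
    fderiv ℝ (fderiv ℝ S.φ) y u v = fderiv ℝ (fderiv ℝ S.φ) y v u :=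
  (S.contDiffAt_φ hy).isSymmSndFDerivAt minSmoothness_two_le u v

theorem fderiv_fderiv_apply {y : E} (hy : y ∈ S.U) (u v : E) :
    fderiv ℝ (fderiv ℝ S.φ) y u v = fderiv ℝ (fun z => fderiv ℝ S.φ z v) y u := by
  have h : DifferentiableAt ℝ (fderiv ℝ S.φ) y :=
    (S.contDiffAt_fderiv_φ hy).differentiableAt (by simp)
  rw [fderiv_clm_apply h (by fun_prop)]
  simp

/-- The metric and the Ricci tensor have no mixed component, so the mixed Hessian vanishes; its only
connection term is (a'/a)u. -/
theorem soliton_time_space {y : E} (hy : y ∈ S.U) {u : E} (hu : S.T u = 0) :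
    fderiv ℝ (fderiv ℝ S.φ) y S.r₀ u =
      deriv S.a (S.T y) / S.a (S.T y) * fderiv ℝ S.φ y u := by
  have h := S.soliton y hy S.r₀ u
  have hG : S.G y S.r₀ u = 0 := by
    rw [WarpedSplitting.G, S.metric_apply, hu, S.H_r₀_left]; simp
  rw [hessian, S.christoffel_G hy, S.warpedΓ_apply, S.ricci_G hy, S.ricci_base_r₀_left hy.1, hG,
    S.Γ_r₀_left hy.1, S.H_r₀_left, hu, S.proj_r₀, S.T_r₀, S.proj_of_T_eq_zero hu] at h
  simp only [map_add, map_smul, smul_eq_mul] at h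
  simp at h
  linarith

/-- Used to eliminate λ + τr from the spatial component. -/
theorem soliton_time_time {y : E} (hy : y ∈ S.U) :
    S.lam + S.τ * scalarCurvature S.G y =
      (Module.finrank ℝ E - 1) * (deriv (deriv S.a) (S.T y) / S.a (S.T y))
        - fderiv ℝ (fderiv ℝ S.φ) y S.r₀ S.r₀ := by
  have h := S.soliton y hy S.r₀ S.r₀
  have hG : S.G y S.r₀ S.r₀ = -1 := by
    rw [WarpedSplitting.G, S.metric_apply, S.T_r₀, S.H_r₀_left]; simp
  rw [hessian, S.christoffel_G hy, S.warpedΓ_apply, S.ricci_G hy, S.ricci_base_r₀_left hy.1, hG,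
    S.Γ_r₀_left hy.1, S.H_r₀_left, S.proj_r₀, S.T_r₀] at h
  simp at h
  linarith

theorem soliton_space_space {y : E} (hy : y ∈ S.U) {u v : E} (hu : S.T u = 0) (hv : S.T v = 0) :
    fderiv ℝ (fderiv ℝ S.φ) y u v - fderiv ℝ S.φ y (S.Γ y u v) + ricci S.base y u v =
      (S.a (S.T y) * deriv S.a (S.T y) * fderiv ℝ S.φ y S.r₀
        - (S.a (S.T y) * deriv (deriv S.a) (S.T y)
          + (Module.finrank ℝ E - 2) * deriv S.a (S.T y) ^ 2)
        + S.a (S.T y) ^ 2 *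
          ((Module.finrank ℝ E - 1) * (deriv (deriv S.a) (S.T y) / S.a (S.T y))
            - fderiv ℝ (fderiv ℝ S.φ) y S.r₀ S.r₀)) * S.H y u v := by
  have h := S.soliton y hy u v
  have hG : S.G y u v = S.a (S.T y) ^ 2 * S.H y u v := by
    rw [WarpedSplitting.G, S.metric_apply, hu]; simp
  rw [hessian, S.christoffel_G hy, S.warpedΓ_apply, S.ricci_G hy, hG, S.soliton_time_time hy,
    hu, hv] at h
  simp only [map_add, map_smul, smul_eq_mul] at h
  simp at h
  linarith

/-- The point at time `t` on the time line through `y`. -/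
def slide (t : ℝ) (y : E) : E := y + (t - S.T y) • S.r₀

theorem T_slide (t : ℝ) (y : E) : S.T (S.slide t y) = t := by simp [slide, S.T_r₀]

theorem slide_mem {t : ℝ} (ht : t ∈ S.J) {y : E} (hy : y ∈ S.W) : S.slide t y ∈ S.U :=
  ⟨S.add_mem y hy _, by rw [Set.mem_preimage, T_slide]; exact ht⟩

theorem slide_self (y : E) : S.slide (S.T y) y = y := by simp [slide]

theorem slide_add (t : ℝ) (y : E) (s : ℝ) : S.slide t (y + s • S.r₀) = S.slide t y := by
  simp only [slide, map_add, map_smul, S.T_r₀, smul_eq_mul, mul_one]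
  module

/-- Here 1/a is the integrating factor of the ODE in `soliton_time_space`. -/
theorem hasDerivAt_fderiv_slide {y : E} (hy : y ∈ S.W) {t : ℝ} (ht : t ∈ S.J) {u : E}
    (hu : S.T u = 0) :
    HasDerivAt (fun t => fderiv ℝ S.φ (S.slide t y) u / S.a t) 0 t := by
  have hmem := S.slide_mem ht hy
  have h1 : HasDerivAt (fun t => S.slide t y) S.r₀ t := by
    simpa [slide] using (((hasDerivAt_id t).sub_const (S.T y)).smul_const S.r₀).const_add y
  have h2 : HasFDerivAt (fun z => fderiv ℝ S.φ z u) _ (S.slide t y) :=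
    ((((S.contDiffAt_fderiv_φ hmem).clm_apply contDiffAt_const).differentiableAt
      (by simp)).hasFDerivAt)
  have h3 := (h2.comp_hasDerivAt t h1).div (S.hasDerivAt_a ht) (S.a_ne ht)
  refine h3.congr_deriv ?_
  rw [← S.fderiv_fderiv_apply hmem, S.soliton_time_space hmem hu, S.T_slide]
  have ha := S.a_ne ht
  simp only [Function.comp_apply]
  field_simp
  ring

theorem fderiv_slide_div {y : E} (hy : y ∈ S.W) {t t' : ℝ} (ht : t ∈ S.J) (ht' : t' ∈ S.J) {u : E}
    (hu : S.T u = 0) :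
    fderiv ℝ S.φ (S.slide t y) u / S.a t = fderiv ℝ S.φ (S.slide t' y) u / S.a t' := by
  have hconv : Convex ℝ S.J := S.ordConnected_J.convex
  refine hconv.is_const_of_fderivWithin_eq_zero (𝕜 := ℝ)
    (f := fun t => fderiv ℝ S.φ (S.slide t y) u / S.a t)
    (fun s hs => (S.hasDerivAt_fderiv_slide hy hs hu).differentiableAt.differentiableWithinAt)
    (fun s hs => ?_) ht ht'
  rw [fderivWithin_of_isOpen S.isOpen_J hs, (S.hasDerivAt_fderiv_slide hy hs hu).hasFDerivAt.fderiv]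
  ext
  simp

/-- The spatial part of the differential of the potential at time `t`, divided by the warping
function. It does not depend on `t ∈ J`. -/
def θ (t : ℝ) (y : E) : E →L[ℝ] ℝ := (S.a t)⁻¹ • (fderiv ℝ S.φ (S.slide t y)).comp S.proj

/-- The spatial covariant derivative of `θ`. -/
def hessθ (t : ℝ) (y u v : E) : ℝ :=
  fderiv ℝ (S.θ t) y u v - S.θ t y (S.Γ y u v)

/-- The factor in the spatial part of the soliton equation. -/
def Ψ (y : E) : ℝ :=
  S.a (S.T y) * deriv S.a (S.T y) * fderiv ℝ S.φ y S.r₀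
    - (S.a (S.T y) * deriv (deriv S.a) (S.T y)
      + (Module.finrank ℝ E - 2) * deriv S.a (S.T y) ^ 2)
    + S.a (S.T y) ^ 2 *
      ((Module.finrank ℝ E - 1) * (deriv (deriv S.a) (S.T y) / S.a (S.T y))
        - fderiv ℝ (fderiv ℝ S.φ) y S.r₀ S.r₀)

variable {t : ℝ}

theorem θ_add (y : E) (s : ℝ) : S.θ t (y + s • S.r₀) = S.θ t y := by
  simp only [θ, S.slide_add]

theorem θ_r₀ (y : E) : S.θ t y S.r₀ = 0 := by simp [θ, S.proj_r₀]

theorem θ_proj (y u : E) : S.θ t y (S.proj u) = S.θ t y u := by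
  simp [θ, S.proj_of_T_eq_zero (S.T_proj _)]

theorem hessθ_add (y : E) (s : ℝ) : S.hessθ t (y + s • S.r₀) = S.hessθ t y := by
  have h : fderiv ℝ (S.θ t) (y + s • S.r₀) = fderiv ℝ (S.θ t) y := by
    rw [← fderiv_comp_add_right]
    simp only [S.θ_add]
  ext u v
  simp only [hessθ, h, S.θ_add, S.Γ_add]

variable (ht : t ∈ S.J)

include ht

theorem contDiffAt_θ {y : E} (hy : y ∈ S.W) : ContDiffAt ℝ ∞ (S.θ t) y := by
  have h1 : ContDiffAt ℝ ∞ (S.slide t) y :=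
    contDiffAt_id.add ((contDiffAt_const.sub S.T.contDiff.contDiffAt).smul contDiffAt_const)
  have h2 : ContDiffAt ℝ ∞ (fun y => fderiv ℝ S.φ (S.slide t y)) y :=
    ContDiffAt.comp y (S.contDiffAt_fderiv_φ (S.slide_mem ht hy)) h1
  exact ContDiffAt.const_smul _ (h2.clm_comp contDiffAt_const)

theorem differentiableAt_θ {y : E} (hy : y ∈ S.W) : DifferentiableAt ℝ (S.θ t) y :=
  (S.contDiffAt_θ ht hy).differentiableAt (by simp)

theorem fderiv_φ_eq {y : E} (hy : y ∈ S.U) {u : E} (hu : S.T u = 0) :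
    fderiv ℝ S.φ y u = S.a (S.T y) * S.θ t y u := by
  have h := S.fderiv_slide_div hy.1 hy.2 ht hu
  rw [S.slide_self] at h
  have ha := S.a_ne hy.2
  have hθ : S.θ t y u = fderiv ℝ S.φ (S.slide t y) u / S.a t := by
    simp [θ, S.proj_of_T_eq_zero hu]; ring
  rw [hθ, ← h]
  field_simp

theorem fderiv_θ_apply {y : E} (hy : y ∈ S.W) (u v : E) :
    fderiv ℝ (S.θ t) y u v = fderiv ℝ (fun z => S.θ t z v) y u := by
  rw [fderiv_clm_apply (S.differentiableAt_θ ht hy) (by fun_prop)]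
  simp

theorem fderiv_θ_r₀ {y : E} (hy : y ∈ S.W) (u : E) : fderiv ℝ (S.θ t) y u S.r₀ = 0 := by
  rw [S.fderiv_θ_apply ht hy]
  simp [S.θ_r₀]

theorem fderiv_θ_time {y : E} (hy : y ∈ S.W) : fderiv ℝ (S.θ t) y S.r₀ = 0 :=
  S.fderiv_apply_r₀_of_add (S.θ_add y) (S.differentiableAt_θ ht hy)

theorem fderiv_fderiv_φ_eq {y : E} (hy : y ∈ S.U) (u : E) {v : E} (hv : S.T v = 0) :
    fderiv ℝ (fderiv ℝ S.φ) y u v =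
      deriv S.a (S.T y) * S.T u * S.θ t y v + S.a (S.T y) * fderiv ℝ (S.θ t) y u v := by
  have h1 : (fun z => fderiv ℝ S.φ z v) =ᶠ[𝓝 y] fun z => S.a (S.T z) * S.θ t z v := by
    filter_upwards [S.isOpen_U.mem_nhds hy] with z hz using S.fderiv_φ_eq ht hz hv
  have h2 : HasFDerivAt (fun z => S.θ t z v) _ y :=
    (((S.contDiffAt_θ ht hy.1).clm_apply contDiffAt_const).differentiableAt (by simp)).hasFDerivAt
  have h3 := ((S.hasDerivAt_a hy.2).comp_hasFDerivAt y S.T.hasFDerivAt).mul h2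
  rw [S.fderiv_fderiv_apply hy, h1.fderiv_eq, S.fderiv_θ_apply ht hy.1]
  have h4 : HasFDerivAt (fun z => S.a (S.T z) * S.θ t z v) _ y := h3
  rw [h4.fderiv]
  simp
  ring

theorem hessθ_proj {y : E} (hy : y ∈ S.W) (u v : E) :
    S.hessθ t y (S.proj u) (S.proj v) = S.hessθ t y u v := by
  simp [hessθ, S.proj_apply, S.fderiv_θ_time ht hy, S.fderiv_θ_r₀ ht hy, S.Γ_r₀ hy,
    S.Γ_r₀_left hy]

/-- The spatial component with the time dependence separated: along a time line only the scalars a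
and Ψ vary. -/
theorem hessθ_add_ricci {y : E} (hy : y ∈ S.U) (u v : E) :
    S.a (S.T y) * S.hessθ t y u v + ricci S.base y u v = S.Ψ y * S.H y u v := by
  have h := S.soliton_space_space hy (S.T_proj u) (S.T_proj v)
  rw [S.fderiv_φ_eq ht hy (S.T_Γ hy.1 _ _), S.fderiv_fderiv_φ_eq ht hy _ (S.T_proj v), S.T_proj u,
    S.ricci_base_proj hy.1, S.ricci_base_proj_left hy.1, S.H_proj, S.H_proj_left] at h
  rw [Ψ, ← h, ← S.hessθ_proj ht hy.1, hessθ]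
  ring

end SolitonSplitting

/-! ### The Einstein condition on the fibre and the vanishing of θ. -/

namespace SolitonSplitting

variable {E : Type*} [NormedAddCommGroup E] [NormedSpace ℝ E] [FiniteDimensional ℝ E]
  (S : SolitonSplitting E)

theorem exists_a_ne {t₁ : ℝ} (ht₁ : t₁ ∈ S.J) (h : deriv (deriv S.a) t₁ ≠ 0) (t : ℝ) :
    ∃ t' ∈ S.J, S.a t' ≠ S.a t := by
  by_contra! hc
  have h1 : ∀ s ∈ S.J, deriv S.a s = 0 := fun s hs => by
    have : S.a =ᶠ[𝓝 s] fun _ => S.a t := by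
      filter_upwards [S.isOpen_J.mem_nhds hs] with r hr using hc r hr
    rw [this.deriv_eq]; simp
  have h2 : deriv S.a =ᶠ[𝓝 t₁] fun _ => 0 := by
    filter_upwards [S.isOpen_J.mem_nhds ht₁] with r hr using h1 r hr
  rw [h2.deriv_eq] at h
  simp at h

/-- If the warping function is not constant, then the spatial metric is Einstein. -/
theorem ricci_base_eq (hE : 2 ≤ Module.finrank ℝ E) {t₁ : ℝ} (ht₁ : t₁ ∈ S.J)
    (h : deriv (deriv S.a) t₁ ≠ 0) {y : E} (hy : y ∈ S.U) (u v : E) :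
    ricci S.base y u v = S.spatialScalar y / (Module.finrank ℝ E - 1) * S.H y u v := by
  obtain ⟨t', ht', hne⟩ := S.exists_a_ne ht₁ h (S.T y)
  have hne' : S.a t' - S.a (S.T y) ≠ 0 := sub_ne_zero.2 hne
  have h1 := S.hessθ_add_ricci ht₁ hy
  have h2 := S.hessθ_add_ricci ht₁ (S.slide_mem ht' hy.1)
  rw [S.T_slide] at h2
  simp only [slide, S.hessθ_add, S.ricci_base_add, S.H_add] at h2
  set Ψ' := S.Ψ (y + (t' - S.T y) • S.r₀)
  have h3 : ∀ u v, ricci S.base y u v =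
      (S.a t' * S.Ψ y - S.a (S.T y) * Ψ') / (S.a t' - S.a (S.T y)) * S.H y u v := by
    intro u v
    rw [div_mul_eq_mul_div, eq_div_iff hne']
    -- The equations at the two times are combined so that the Hessian of θ drops out.
    linear_combination S.a t' * h1 u v - S.a (S.T y) * h2 u v
  have h4 := S.spatialScalar_eq hy.1 fun u v _ _ => h3 u v
  have h5 : (Module.finrank ℝ E : ℝ) - 1 ≠ 0 := by
    have : (2 : ℝ) ≤ Module.finrank ℝ E := by exact_mod_cast hE
    linarith
  rw [h4, mul_div_cancel_left₀ _ h5, h3]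

/-- The conformal factor of the spatial covariant derivative of `θ`. -/
def ψ (y : E) : ℝ :=
  (S.Ψ y - S.spatialScalar y / (Module.finrank ℝ E - 1)) / S.a (S.T y)

theorem hessθ_eq (hE : 2 ≤ Module.finrank ℝ E) {t₁ : ℝ} (ht₁ : t₁ ∈ S.J)
    (h : deriv (deriv S.a) t₁ ≠ 0) {y : E} (hy : y ∈ S.U) (u v : E) :
    S.hessθ t₁ y u v = S.ψ y * S.H y u v := by
  have h1 := S.hessθ_add_ricci ht₁ hy u v
  rw [S.ricci_base_eq hE ht₁ h hy] at h1
  have ha := S.a_ne hy.2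
  rw [ψ, div_mul_eq_mul_div, eq_div_iff ha]
  linear_combination h1

variable {t : ℝ} (ht : t ∈ S.J)

theorem hasFDerivAt_comp_T {c : ℝ → ℝ} {y : E} (hc : DifferentiableAt ℝ c (S.T y)) :
    HasFDerivAt (fun z => c (S.T z)) (deriv c (S.T y) • S.T) y :=
  hc.hasDerivAt.comp_hasFDerivAt y S.T.hasFDerivAt

include ht in
/-- The spatial derivative of a linear combination of the time derivatives of the potential with
coefficients depending on time. -/
theorem hasFDerivAt_time_combination {c₀ c₁ c₂ : ℝ → ℝ} {y : E} (hy : y ∈ S.U)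
    (h₀ : DifferentiableAt ℝ c₀ (S.T y)) (h₁ : DifferentiableAt ℝ c₁ (S.T y))
    (h₂ : DifferentiableAt ℝ c₂ (S.T y)) :
    ∃ Q' : E →L[ℝ] ℝ, HasFDerivAt (fun z => c₀ (S.T z) + c₁ (S.T z) * fderiv ℝ S.φ z S.r₀
        + c₂ (S.T z) * fderiv ℝ (fderiv ℝ S.φ) z S.r₀ S.r₀) Q' y ∧
      ∀ u, S.T u = 0 → Q' u = (c₁ (S.T y) * deriv S.a (S.T y)
        + c₂ (S.T y) * deriv (deriv S.a) (S.T y)) * S.θ t y u := by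
  have hφ₁ : ContDiffAt ℝ ∞ (fun z => fderiv ℝ S.φ z S.r₀) y :=
    (S.contDiffAt_fderiv_φ hy).clm_apply contDiffAt_const
  have hφ₂ : ContDiffAt ℝ ∞ (fun z => fderiv ℝ (fderiv ℝ S.φ) z S.r₀ S.r₀) y :=
    ((S.contDiffAt_fderiv_fderiv_φ hy).clm_apply contDiffAt_const).clm_apply contDiffAt_const
  have d₁ := (hφ₁.differentiableAt (by simp)).hasFDerivAt
  have d₂ := (hφ₂.differentiableAt (by simp)).hasFDerivAt
  refine ⟨_, ((S.hasFDerivAt_comp_T h₀).add ((S.hasFDerivAt_comp_T h₁).mul d₁)).add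
    ((S.hasFDerivAt_comp_T h₂).mul d₂), fun u hu => ?_⟩
  have e₁ : fderiv ℝ (fun z => fderiv ℝ S.φ z S.r₀) y u = deriv S.a (S.T y) * S.θ t y u := by
    rw [← S.fderiv_fderiv_apply hy, S.fderiv_fderiv_symm hy, S.fderiv_fderiv_φ_eq ht hy _ hu,
      S.fderiv_θ_time ht hy.1, S.T_r₀]
    simp
  have e₂ : fderiv ℝ (fun z => fderiv ℝ (fderiv ℝ S.φ) z S.r₀ S.r₀) y u =
      deriv (deriv S.a) (S.T y) * S.θ t y u := by
    have ev₁ : (fun z => fderiv ℝ (fderiv ℝ S.φ) z S.r₀ S.r₀) =ᶠ[𝓝 y]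
        fun z => fderiv ℝ (fun z => fderiv ℝ S.φ z S.r₀) z S.r₀ := by
      filter_upwards [S.isOpen_U.mem_nhds hy] with z hz using S.fderiv_fderiv_apply hz _ _
    have ev₂ : (fun z => fderiv ℝ (fun z => fderiv ℝ S.φ z S.r₀) z u) =ᶠ[𝓝 y]
        fun z => deriv S.a (S.T z) * S.θ t z u := by
      filter_upwards [S.isOpen_U.mem_nhds hy] with z hz
      rw [← S.fderiv_fderiv_apply hz, S.fderiv_fderiv_symm hz, S.fderiv_fderiv_φ_eq ht hz _ hu,
        S.fderiv_θ_time ht hz.1, S.T_r₀]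
      simp
    have hdd : DifferentiableAt ℝ (fderiv ℝ (fun z => fderiv ℝ S.φ z S.r₀)) y :=
      ContDiffAt.differentiableAt (n := ∞) (hφ₁.fderiv_right (by simp)) (by simp)
    have step : ∀ v w, fderiv ℝ (fun z => fderiv ℝ (fun z => fderiv ℝ S.φ z S.r₀) z v) y w =
        fderiv ℝ (fderiv ℝ (fun z => fderiv ℝ S.φ z S.r₀)) y w v := by
      intro v w
      rw [fderiv_clm_apply hdd (by fun_prop)]
      simp
    have hsymm := hφ₁.isSymmSndFDerivAt minSmoothness_two_le u S.r₀
    have hθ : DifferentiableAt ℝ (fun z => S.θ t z u) y :=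
      ((S.contDiffAt_θ ht hy.1).clm_apply contDiffAt_const).differentiableAt (by simp)
    have hθ₀ : fderiv ℝ (fun z => S.θ t z u) y S.r₀ = 0 := by
      rw [← S.fderiv_θ_apply ht hy.1, S.fderiv_θ_time ht hy.1]
      simp
    -- The derivatives of f_t commute: ∂_u ∂_t f_t = ∂_t ∂_u f_t = ∂_t(a'θ(u)) = a''θ(u).
    rw [ev₁.fderiv_eq, step, hsymm, ← step, ev₂.fderiv_eq]
    have d₃ := (S.hasFDerivAt_comp_T (S.hasDerivAt_deriv_a hy.2).differentiableAt).mul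
      hθ.hasFDerivAt
    have d₄ : HasFDerivAt (fun z => deriv S.a (S.T z) * S.θ t z u) _ y := d₃
    rw [d₄.fderiv]
    simp [hθ₀, S.T_r₀, mul_comm]
  simp [e₁, e₂, hu]
  ring

/-- The gradient of the function with differential `θ` for the spatial metric. -/
def V (t : ℝ) (y : E) : E := S.raise y (S.θ t y)

theorem T_V {y : E} (hy : y ∈ S.W) : S.T (S.V t y) = 0 := S.T_raise hy _

theorem H_V {y : E} (hy : y ∈ S.W) (u : E) : S.H y (S.V t y) u = S.θ t y u := by
  rw [V, S.H_raise hy, S.θ_proj]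

include ht in
theorem contDiffAt_V {y : E} (hy : y ∈ S.W) : ContDiffAt ℝ ∞ (S.V t) y := by
  have h1 : ContDiffAt ℝ ∞ (fun y => (S.base y).inverse) y :=
    ContDiffAt.comp y (isInvertible_of_injective (S.base_injective hy)).contDiffAt_map_inverse
      (S.contDiffAt_metric hy contDiffAt_const)
  have hθ := S.contDiffAt_θ ht hy
  exact (h1.clm_apply hθ).add ((hθ.clm_apply contDiffAt_const).smul contDiffAt_const)

/-- That is, ∇V = ψ id on the fibre. It follows by differentiating H(V, z) = θ(z), as the connection
is metric and ∇θ = ψH. -/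
theorem fderiv_V (hE : 2 ≤ Module.finrank ℝ E) (ht : t ∈ S.J)
    (h : deriv (deriv S.a) t ≠ 0) {y : E} (hy : y ∈ S.U) (u : E) :
    fderiv ℝ (S.V t) y u = S.ψ y • S.proj u - S.Γ y u (S.V t y) := by
  have hV : DifferentiableAt ℝ (S.V t) y := (S.contDiffAt_V ht hy.1).differentiableAt (by simp)
  have hW : ∀ᶠ z in 𝓝 y, z ∈ S.W := S.isOpen_W.mem_nhds hy.1
  -- `H` does not see the time component, which is therefore treated separately.
  have hT : S.T (fderiv ℝ (S.V t) y u) = 0 := by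
    have h1 : (fun z => S.T (S.V t z)) =ᶠ[𝓝 y] fun _ => 0 := by
      filter_upwards [hW] with z hz using S.T_V hz
    have h2 : HasFDerivAt (fun z => S.T (S.V t z)) (S.T.comp (fderiv ℝ (S.V t) y)) y :=
      S.T.hasFDerivAt.comp y hV.hasFDerivAt
    have h3 := h2.fderiv
    rw [h1.fderiv_eq] at h3
    simpa using (congrArg (fun l : E →L[ℝ] ℝ => l u) h3).symm
  refine S.eq_of_base hy.1 fun z => ?_
  have h1 : (fun x => S.H x (S.V t x) z) =ᶠ[𝓝 y] fun x => S.θ t x z := by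
    filter_upwards [hW] with x hx using S.H_V hx z
  have h2 : fderiv ℝ (fun x => S.H x (S.V t x) z) y u =
      S.H y (fderiv ℝ (S.V t) y u) z + fderiv ℝ S.H y u (S.V t y) z := by
    have hH := S.differentiableAt_H hy.1
    rw [fderiv_clm_apply (hH.clm_apply hV) (by fun_prop), fderiv_clm_apply hH hV]
    simp
  rw [h1.fderiv_eq, ← S.fderiv_θ_apply ht hy.1, S.fderiv_H_eq hy.1, S.H_V hy.1] at h2
  have h3 := S.hessθ_eq hE ht h hy u z
  rw [hessθ] at h3
  rw [S.base_apply, S.base_apply, hT, map_sub, map_sub, map_smul, map_smul, S.T_proj,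
    S.T_Γ hy.1, sub_apply, smul_apply, S.H_proj_left, smul_eq_mul, smul_eq_mul]
  linear_combination h3 - h2

/-- The Ricci identity: ∇V = ψ id is differentiated once more and antisymmetrised. The second
derivatives of V cancel by symmetry, the terms ψΓ(u, w) because there is no torsion. -/
theorem riemann_V (hE : 2 ≤ Module.finrank ℝ E) (ht : t ∈ S.J)
    (h : deriv (deriv S.a) t ≠ 0) {y : E} (hy : y ∈ S.U) (hψ : DifferentiableAt ℝ S.ψ y)
    (w u : E) :
    riemann S.base y w u (S.V t y) =
      fderiv ℝ S.ψ y w • S.proj u - fderiv ℝ S.ψ y u • S.proj w := by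
  have hV := S.contDiffAt_V ht hy.1
  have hVd : DifferentiableAt ℝ (S.V t) y := hV.differentiableAt (by simp)
  have hdd : DifferentiableAt ℝ (fderiv ℝ (S.V t)) y :=
    ContDiffAt.differentiableAt (n := ∞) (hV.fderiv_right (by simp)) (by simp)
  have hΓ := S.differentiableAt_Γ hy.1
  have key : ∀ w u, fderiv ℝ (fderiv ℝ (S.V t)) y w u = fderiv ℝ S.ψ y w • S.proj u
      - fderiv ℝ S.Γ y w u (S.V t y) - S.Γ y u (fderiv ℝ (S.V t) y w) := by
    intro w u
    have h1 : fderiv ℝ (fderiv ℝ (S.V t)) y w u = fderiv ℝ (fun z => fderiv ℝ (S.V t) z u) y w := by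
      rw [fderiv_clm_apply hdd (by fun_prop)]
      simp
    have h2 : (fun z => fderiv ℝ (S.V t) z u) =ᶠ[𝓝 y]
        fun z => S.ψ z • S.proj u - S.Γ z u (S.V t z) := by
      filter_upwards [S.isOpen_U.mem_nhds hy] with z hz using S.fderiv_V hE ht h hz u
    have h3 : DifferentiableAt ℝ (fun z => S.Γ z u) y := hΓ.clm_apply (by fun_prop)
    rw [h1, h2.fderiv_eq, fderiv_fun_sub (hψ.smul_const _) (h3.clm_apply hVd),
      fderiv_smul_const hψ, fderiv_clm_apply h3 hVd, fderiv_clm_apply hΓ (by fun_prop)]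
    simp
    abel
  have hs := hV.isSymmSndFDerivAt minSmoothness_two_le w u
  rw [key, key, S.fderiv_V hE ht h hy, S.fderiv_V hE ht h hy] at hs
  simp only [map_sub, map_smul, S.Γ_proj hy.1] at hs
  rw [S.riemann_base hy.1]
  rw [S.Γ_symm hy.1 w u] at hs
  rw [← sub_eq_zero] at hs ⊢
  rw [← neg_eq_zero, ← hs]
  abel

theorem ricci_V (hE : 2 ≤ Module.finrank ℝ E) (ht : t ∈ S.J)
    (h : deriv (deriv S.a) t ≠ 0) {y : E} (hy : y ∈ S.U) (hψ : DifferentiableAt ℝ S.ψ y)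
    {u : E} (hu : S.T u = 0) :
    ricci S.base y u (S.V t y) = (2 - Module.finrank ℝ E) * fderiv ℝ S.ψ y u := by
  have h1 : ∑ i, fderiv ℝ S.ψ y (Module.finBasis ℝ E i) * (Module.finBasis ℝ E).coord i u =
      fderiv ℝ S.ψ y u := by
    simpa only [map_smul, smul_eq_mul] using sum_coord_smul (fderiv ℝ S.ψ y) u
  simp only [ricci, S.riemann_V hE ht h hy hψ, S.proj_of_T_eq_zero hu, map_sub, map_smul,
    smul_eq_mul, Finset.sum_sub_distrib, h1, ← Finset.mul_sum, S.sum_coord_proj]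
  ring

/-- The part of the time-time component of the soliton equation that depends on time only. -/
def timePart (t : ℝ) : ℝ :=
  S.a t ^ 2 * ((Module.finrank ℝ E - 1) * (deriv (deriv S.a) t / S.a t) - S.lam
      - S.τ * ((Module.finrank ℝ E - 1) * (deriv (deriv S.a) t / S.a t)))
    - S.τ * ((Module.finrank ℝ E - 1) * (S.a t * deriv (deriv S.a) t
      + (Module.finrank ℝ E - 2) * deriv S.a t ^ 2))

theorem differentiableAt_a (ht : t ∈ S.J) : DifferentiableAt ℝ S.a t :=
  (S.hasDerivAt_a ht).differentiableAt

theorem differentiableAt_deriv_a (ht : t ∈ S.J) : DifferentiableAt ℝ (deriv S.a) t :=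
  (S.hasDerivAt_deriv_a ht).differentiableAt

theorem differentiableAt_deriv_deriv_a (ht : t ∈ S.J) :
    DifferentiableAt ℝ (deriv (deriv S.a)) t :=
  (S.contDiffAt_deriv_deriv_a ht).differentiableAt (by simp)

theorem differentiableAt_timePart (ht : t ∈ S.J) : DifferentiableAt ℝ S.timePart t := by
  have h0 := S.differentiableAt_a ht
  have h1 := S.differentiableAt_deriv_a ht
  have h2 := S.differentiableAt_deriv_deriv_a ht
  have ha := S.a_ne ht
  unfold timePart
  fun_prop (disch := exact ha)

/-- The time component multiplied by a². It ties the spatial variation of the fibre scalar curvature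
to that of f_tt, hence to a''θ. -/
theorem τ_mul_spatialScalar {y : E} (hy : y ∈ S.U) :
    S.τ * S.spatialScalar y = S.timePart (S.T y)
      - S.a (S.T y) ^ 2 * fderiv ℝ (fderiv ℝ S.φ) y S.r₀ S.r₀ := by
  have h := S.soliton_time_time hy
  rw [S.scalarCurvature_G hy] at h
  have ha := S.a_ne hy.2
  rw [timePart]
  field_simp at h ⊢
  linear_combination h

include ht in
/-- If `τ` times the spatial scalar curvature is a function of time, then the spatial part of the
differential of the potential vanishes where the warping function has non-zero second derivative. -/
theorem θ_eq_zero_of_spatialScalar {y : E} (hy : y ∈ S.U) (h : deriv (deriv S.a) (S.T y) ≠ 0)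
    {b : ℝ → ℝ} (hb : DifferentiableAt ℝ b (S.T y))
    (hs : ∀ᶠ z in 𝓝 y, S.τ * S.spatialScalar z = b (S.T z)) {u : E} (hu : S.T u = 0) :
    S.θ t y u = 0 := by
  have h2 : DifferentiableAt ℝ (fun t => -S.a t ^ 2) (S.T y) :=
    ((S.differentiableAt_a hy.2).pow 2).neg
  obtain ⟨Q', hQ, hQ'⟩ := S.hasFDerivAt_time_combination ht hy (S.differentiableAt_timePart hy.2)
    (differentiableAt_const 0) h2
  have h4 : HasFDerivAt (fun z => b (S.T z)) Q' y := by
    refine hQ.congr_of_eventuallyEq ?_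
    filter_upwards [hs, S.isOpen_U.mem_nhds hy] with z hz hzU
    rw [← hz, S.τ_mul_spatialScalar hzU]
    ring
  -- On spatial vectors the derivative is -a²a''θ(u), while a function of time has derivative zero
  -- there.
  have h5 := hQ' u hu
  rw [h4.unique (S.hasFDerivAt_comp_T hb)] at h5
  have ha := S.a_ne hy.2
  simpa [hu, ha, h] using h5

/-- As τ ≠ 0, `τ_mul_spatialScalar` can be solved for the fibre scalar curvature. Then ψ is a
combination of 1, f_t and f_tt with coefficients depending on time, which gives both its
differentiability and dψ = e(t)θ on spatial vectors. -/
theorem exists_fderiv_ψ (hE : 2 ≤ Module.finrank ℝ E) (ht : t ∈ S.J) (hτ : S.τ ≠ 0) :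
    ∃ e : ℝ → ℝ, (∀ s ∈ S.J, DifferentiableAt ℝ e s) ∧ ∀ y ∈ S.U, DifferentiableAt ℝ S.ψ y ∧
      ∀ u, S.T u = 0 → fderiv ℝ S.ψ y u = e (S.T y) * S.θ t y u := by
  have hn : (Module.finrank ℝ E : ℝ) - 1 ≠ 0 := by
    have : (2 : ℝ) ≤ Module.finrank ℝ E := by exact_mod_cast hE
    linarith
  let c₀ : ℝ → ℝ := fun t => (-(S.a t * deriv (deriv S.a) t
      + (Module.finrank ℝ E - 2) * deriv S.a t ^ 2)
    + S.a t ^ 2 * ((Module.finrank ℝ E - 1) * (deriv (deriv S.a) t / S.a t))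
    - S.timePart t / (S.τ * (Module.finrank ℝ E - 1))) / S.a t
  let c₂ : ℝ → ℝ := fun t => S.a t / (S.τ * (Module.finrank ℝ E - 1)) - S.a t
  have hc₀ : ∀ s ∈ S.J, DifferentiableAt ℝ c₀ s := by
    intro s hs
    have h0 := S.differentiableAt_a hs
    have h1 := S.differentiableAt_deriv_a hs
    have h2 := S.differentiableAt_deriv_deriv_a hs
    have h3 := S.differentiableAt_timePart hs
    have ha := S.a_ne hs
    simp only [c₀]
    fun_prop (disch := first | exact ha | exact mul_ne_zero hτ hn)
  have hc₂ : ∀ s ∈ S.J, DifferentiableAt ℝ c₂ s := by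
    intro s hs
    have h0 := S.differentiableAt_a hs
    simp only [c₂]
    fun_prop (disch := exact mul_ne_zero hτ hn)
  have hψ : ∀ y ∈ S.U, S.ψ y = c₀ (S.T y) + deriv S.a (S.T y) * fderiv ℝ S.φ y S.r₀
      + c₂ (S.T y) * fderiv ℝ (fderiv ℝ S.φ) y S.r₀ S.r₀ := by
    intro y hy
    have ha := S.a_ne hy.2
    have hs : S.spatialScalar y = (S.timePart (S.T y)
      - S.a (S.T y) ^ 2 * fderiv ℝ (fderiv ℝ S.φ) y S.r₀ S.r₀) / S.τ := by
      rw [← S.τ_mul_spatialScalar hy, mul_div_cancel_left₀ _ hτ]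
    simp only [ψ, Ψ, hs, c₀, c₂]
    field_simp
    ring
  refine ⟨fun t => deriv S.a t * deriv S.a t + c₂ t * deriv (deriv S.a) t, fun s hs => ?_,
    fun y hy => ?_⟩
  · have h1 := S.differentiableAt_deriv_a hs
    have h2 := S.differentiableAt_deriv_deriv_a hs
    have h3 := hc₂ s hs
    fun_prop
  · obtain ⟨Q', hQ, hQ'⟩ := S.hasFDerivAt_time_combination ht hy (hc₀ _ hy.2)
      (S.differentiableAt_deriv_a hy.2) (hc₂ _ hy.2)
    have h1 : HasFDerivAt S.ψ Q' y := by
      refine hQ.congr_of_eventuallyEq ?_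
      filter_upwards [S.isOpen_U.mem_nhds hy] with z hz using hψ z hz
    refine ⟨h1.differentiableAt, fun u hu => ?_⟩
    rw [h1.fderiv, hQ' u hu]

theorem θ_eq_zero (hE : 2 ≤ Module.finrank ℝ E) (ht : t ∈ S.J)
    (h : deriv (deriv S.a) t ≠ 0) {y : E} (hy : y ∈ S.U) (hyt : S.T y = t)
    {u : E} (hu : S.T u = 0) : S.θ t y u = 0 := by
  by_cases hτ : S.τ = 0
  · exact S.θ_eq_zero_of_spatialScalar ht hy (by rwa [hyt]) (differentiableAt_const 0)
      (Eventually.of_forall fun z => by simp [hτ]) hu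
  have hn : (Module.finrank ℝ E : ℝ) - 1 ≠ 0 := by
    have : (2 : ℝ) ≤ Module.finrank ℝ E := by exact_mod_cast hE
    linarith
  obtain ⟨e, he, hψ⟩ := S.exists_fderiv_ψ hE ht hτ
  -- If θ(u) ≠ 0 at `y`, then also nearby, where θ(u) can be cancelled from the Ricci identity.
  by_contra hne
  have hcont : ContinuousAt (fun z => S.θ t z u) y :=
    ((S.contDiffAt_θ ht hy.1).clm_apply contDiffAt_const).continuousAt
  refine hne (S.θ_eq_zero_of_spatialScalar ht hy (by rwa [hyt])
    -- The value of τr* obtained from r*/(n-1) θ(u) = Ric*(u, V) = (2-n)e(t)θ(u).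
    (b := fun s => S.τ * ((Module.finrank ℝ E - 1) * (2 - Module.finrank ℝ E)) * e s)
    ((he _ hy.2).const_mul _) ?_ hu)
  filter_upwards [S.isOpen_U.mem_nhds hy, hcont.eventually_ne hne] with z hz hzne
  have h1 := S.ricci_V hE ht h hz (hψ z hz).1 hu
  rw [S.ricci_base_eq hE ht h hz, S.H_symm, S.H_V hz.1, (hψ z hz).2 u hu, ← mul_assoc] at h1
  have h2 := mul_right_cancel₀ hzne h1
  rw [div_eq_iff hn] at h2
  rw [h2]
  ring

/-- Each time line meets the slice at time `t`, where θ vanishes, and θ is constant along it. So a''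
may vanish at the time of `y` itself. -/
theorem fderiv_φ_eq_zero (hE : 2 ≤ Module.finrank ℝ E) (ht : t ∈ S.J)
    (h : deriv (deriv S.a) t ≠ 0) {y : E} (hy : y ∈ S.U) {u : E} (hu : S.T u = 0) :
    fderiv ℝ S.φ y u = 0 := by
  have h1 := S.θ_eq_zero hE ht h (S.slide_mem ht hy.1) (S.T_slide t y) hu
  rw [slide, S.θ_add] at h1
  rw [S.fderiv_φ_eq ht hy hu, h1, mul_zero]

end SolitonSplitting

/-! ### Charts of the smooth structure and smoothness in charts. -/

section Charts

variable {E : Type*} [NormedAddCommGroup E] [NormedSpace ℝ E]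
  {M : Type*} [TopologicalSpace M] [ChartedSpace E M] [IsManifold 𝓘(ℝ, E) ∞ M]

theorem mem_contDiffGroupoid_of_contDiffOn {e : OpenPartialHomeomorph E E}
    (h : ContDiffOn ℝ ∞ e e.source) (h' : ContDiffOn ℝ ∞ e.symm e.target) :
    e ∈ contDiffGroupoid ∞ 𝓘(ℝ, E) := by
  rw [contDiffGroupoid, mem_groupoid_of_pregroupoid]
  constructor
  · simpa [contDiffPregroupoid] using h
  · simpa [contDiffPregroupoid] using h'

/-- The curvature hypotheses are stated for charts of the maximal atlas; this criterion makes the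
product charts eligible. -/
theorem mem_maximalAtlas_of_contMDiffOn {e : OpenPartialHomeomorph M E}
    (h : ContMDiffOn 𝓘(ℝ, E) 𝓘(ℝ, E) ∞ e e.source)
    (h' : ContMDiffOn 𝓘(ℝ, E) 𝓘(ℝ, E) ∞ e.symm e.target) :
    e ∈ IsManifold.maximalAtlas 𝓘(ℝ, E) ∞ M := by
  have key : ∀ e₁ e₂ : OpenPartialHomeomorph M E,
      ContMDiffOn 𝓘(ℝ, E) 𝓘(ℝ, E) ∞ e₁.symm e₁.target →
      ContMDiffOn 𝓘(ℝ, E) 𝓘(ℝ, E) ∞ e₂ e₂.source →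
      ContDiffOn ℝ ∞ (e₁.symm.trans e₂) (e₁.symm.trans e₂).source := by
    intro e₁ e₂ h₁ h₂
    rw [← contMDiffOn_iff_contDiffOn]
    refine h₂.comp (h₁.mono ?_) ?_
    · intro x hx; simp at hx; exact hx.1
    · intro x hx; simp at hx; exact hx.2
  intro e' he'
  have hm : e' ∈ IsManifold.maximalAtlas 𝓘(ℝ, E) ∞ M :=
    IsManifold.subset_maximalAtlas he'
  have h₁ := contMDiffOn_of_mem_maximalAtlas hm
  have h₂ := contMDiffOn_symm_of_mem_maximalAtlas hm
  exact ⟨mem_contDiffGroupoid_of_contDiffOn (key e e' h' h₁) (key e' e h₂ h),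
    mem_contDiffGroupoid_of_contDiffOn (key e' e h₂ h) (key e e' h' h₁)⟩

theorem mdifferentiable_of_mem_maximalAtlas {e : OpenPartialHomeomorph M E}
    (he : e ∈ IsManifold.maximalAtlas 𝓘(ℝ, E) ∞ M) :
    e.MDifferentiable 𝓘(ℝ, E) 𝓘(ℝ, E) :=
  ⟨(contMDiffOn_of_mem_maximalAtlas he).mdifferentiableOn (by simp),
    (contMDiffOn_symm_of_mem_maximalAtlas he).mdifferentiableOn (by simp)⟩

/-- The coordinate vector field `∂_u` of a chart is smooth. -/
theorem contMDiffOn_coordinate_field {e : OpenPartialHomeomorph M E}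
    (he : e ∈ IsManifold.maximalAtlas 𝓘(ℝ, E) ∞ M) (u : E) :
    ContMDiffOn 𝓘(ℝ, E) (𝓘(ℝ, E).prod 𝓘(ℝ, E)) ∞
      (fun w => Bundle.TotalSpace.mk' E (E := fun x : M => TangentSpace 𝓘(ℝ, E) x) (e.symm w)
        (mfderiv 𝓘(ℝ, E) 𝓘(ℝ, E) e.symm w u)) e.target := by
  have : IsManifold 𝓘(ℝ, E) 1 M := IsManifold.of_le (n := ∞) (by simp)
  have h1 := (contMDiffOn_symm_of_mem_maximalAtlas he).contMDiffOn_tangentMapWithin (m := ∞)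
    (by simp) e.open_target.uniqueMDiffOn
  have h2 : ContMDiffOn 𝓘(ℝ, E) (𝓘(ℝ, E).prod 𝓘(ℝ, E)) ∞
      (fun w : E => (⟨w, u⟩ : TangentBundle 𝓘(ℝ, E) E)) e.target :=
    contMDiffOn_vectorSpace_iff_contDiffOn.2 contDiffOn_const
  refine (h1.comp h2 fun w hw => hw).congr fun w hw => ?_
  simp only [Function.comp_apply, tangentMapWithin]
  rw [mfderivWithin_of_isOpen e.open_target hw]

/-- A smooth field of bilinear forms is smooth in a chart. -/
theorem contDiffOn_form_chart
    {h : (x : M) → TangentSpace 𝓘(ℝ, E) x →L[ℝ] TangentSpace 𝓘(ℝ, E) x →L[ℝ] ℝ}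
    (hh : ContMDiff 𝓘(ℝ, E) (𝓘(ℝ, E).prod 𝓘(ℝ, E →L[ℝ] E →L[ℝ] ℝ)) ∞
      (fun p => Bundle.TotalSpace.mk' (E →L[ℝ] E →L[ℝ] ℝ)
        (E := fun p : M => TangentSpace 𝓘(ℝ, E) p →L[ℝ] TangentSpace 𝓘(ℝ, E) p →L[ℝ] ℝ)
        p (h p)))
    {e : OpenPartialHomeomorph M E} (he : e ∈ IsManifold.maximalAtlas 𝓘(ℝ, E) ∞ M) (u v : E) :
    ContDiffOn ℝ ∞ (fun w => h (e.symm w) (mfderiv 𝓘(ℝ, E) 𝓘(ℝ, E) e.symm w u)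
      (mfderiv 𝓘(ℝ, E) 𝓘(ℝ, E) e.symm w v)) e.target := by
  have : IsManifold 𝓘(ℝ, E) 1 M := IsManifold.of_le (n := ∞) (by simp)
  have h1 := hh.comp_contMDiffOn (contMDiffOn_symm_of_mem_maximalAtlas he)
  have h2 := ContMDiffOn.clm_bundle_apply₂ (F₁ := E) (F₂ := E) (F₃ := ℝ)
    (E₁ := fun x : M => TangentSpace 𝓘(ℝ, E) x) (E₂ := fun x : M => TangentSpace 𝓘(ℝ, E) x)
    (E₃ := Bundle.Trivial M ℝ) h1
    (contMDiffOn_coordinate_field he u) (contMDiffOn_coordinate_field he v)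
  intro w hw
  have h3 := (Bundle.contMDiffWithinAt_totalSpace.1 (h2 w hw)).2
  exact contMDiffWithinAt_iff_contDiffWithinAt.1 h3

/-- The inverse of the chart of an open interval has derivative `1`. -/
theorem hasMFDerivAt_interval_chart_symm (J : TopologicalSpace.Opens ℝ) (t₀ : J) {t : ℝ}
    (ht : t ∈ (chartAt ℝ t₀).target) :
    HasMFDerivAt 𝓘(ℝ, ℝ) 𝓘(ℝ, ℝ) (chartAt ℝ t₀).symm t (ContinuousLinearMap.id ℝ ℝ) := by
  refine ⟨(chartAt ℝ t₀).continuousAt_symm ht, ?_⟩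
  have h : (fun s => (chartAt ℝ t₀) ((chartAt ℝ t₀).symm s)) =ᶠ[𝓝 t] id := by
    filter_upwards [(chartAt ℝ t₀).open_target.mem_nhds ht] with s hs
      using (chartAt ℝ t₀).right_inv hs
  have h2 : HasFDerivAt (fun s => (chartAt ℝ t₀) ((chartAt ℝ t₀).symm s))
      (ContinuousLinearMap.id ℝ ℝ) t := (hasFDerivAt_id t).congr_of_eventuallyEq h
  exact h2.hasFDerivWithinAt

/-- One chart covers the whole interval, so product charts contain entire time lines and the time t₁
is reached in each of them. -/
theorem interval_chart_source (J : TopologicalSpace.Opens ℝ) (t₀ : J) :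
    (chartAt ℝ t₀).source = Set.univ := by
  simp [TopologicalSpace.Opens.chartAt_eq, chartAt_self_eq]

theorem interval_chart_target (J : TopologicalSpace.Opens ℝ) (t₀ : J) :
    (chartAt ℝ t₀).target = J := by
  ext t
  constructor
  · intro ht
    have h := (chartAt ℝ t₀).right_inv ht
    rw [← h]
    exact ((chartAt ℝ t₀).symm t).2
  · intro ht
    exact (chartAt ℝ t₀).map_source (x := ⟨t, ht⟩) (by rw [interval_chart_source]; trivial)

end Charts

/-! ### Product charts of a GRW spacetime. -/

namespace GRWPresentation

variable {E : Type*} [NormedAddCommGroup E] [NormedSpace ℝ E] [FiniteDimensional ℝ E]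
  {M : Type*} [TopologicalSpace M] [ChartedSpace E M] [IsManifold 𝓘(ℝ, E) ∞ M]
  {g : LorentzianMetric E M}
  {F : Type*} [NormedAddCommGroup F] [NormedSpace ℝ F]
  {N : Type*} [TopologicalSpace N] [ChartedSpace F N] [IsManifold 𝓘(ℝ, F) ∞ N]
  (P : GRWPresentation g F N)

/-- The product chart of the time coordinate and of a chart of the fibre. -/
def chart (L : (ℝ × F) ≃L[ℝ] E) (q : P.J × N) : OpenPartialHomeomorph M E :=
  P.Φ.symm.toHomeomorph.toOpenPartialHomeomorph.trans
    (((chartAt ℝ q.1).prod (chartAt F q.2)).trans L.toHomeomorph.toOpenPartialHomeomorph)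

variable (L : (ℝ × F) ≃L[ℝ] E) (q : P.J × N)

/-- The inverse of the product chart, without the diffeomorphism `Φ`. -/
def chartSymm (y : E) : P.J × N :=
  ((chartAt ℝ q.1).symm (L.symm y).1, (chartAt F q.2).symm (L.symm y).2)

theorem mem_chart_source {p : M} :
    p ∈ (P.chart L q).source ↔ (P.Φ.symm p).2 ∈ (chartAt F q.2).source := by
  simp [chart, interval_chart_source]

theorem mem_chart_target {y : E} :
    y ∈ (P.chart L q).target ↔ (L.symm y).1 ∈ P.J ∧ (L.symm y).2 ∈ (chartAt F q.2).target := by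
  simp [chart, interval_chart_target]

theorem contMDiffOn_chartSymm :
    ContMDiffOn 𝓘(ℝ, E) (𝓘(ℝ, ℝ).prod 𝓘(ℝ, F)) ∞ (P.chartSymm L q) (P.chart L q).target := by
  have h1 : ContMDiff 𝓘(ℝ, E) 𝓘(ℝ, ℝ) ∞ (fun y => (L.symm y).1) :=
    ((contDiff_fst.comp L.symm.contDiff)).contMDiff
  have h2 : ContMDiff 𝓘(ℝ, E) 𝓘(ℝ, F) ∞ (fun y => (L.symm y).2) :=
    ((contDiff_snd.comp L.symm.contDiff)).contMDiff
  refine ContMDiffOn.prodMk ?_ ?_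
  · exact (contMDiffOn_chart_symm (I := 𝓘(ℝ, ℝ)) (x := q.1)).comp h1.contMDiffOn fun y hy => by
      rw [Set.mem_preimage, interval_chart_target]; exact ((P.mem_chart_target L q).1 hy).1
  · exact (contMDiffOn_chart_symm (I := 𝓘(ℝ, F)) (x := q.2)).comp h2.contMDiffOn fun y hy =>
      ((P.mem_chart_target L q).1 hy).2

theorem chart_mem_maximalAtlas : P.chart L q ∈ IsManifold.maximalAtlas 𝓘(ℝ, E) ∞ M := by
  refine mem_maximalAtlas_of_contMDiffOn ?_ ?_
  · have h1 : ContMDiff 𝓘(ℝ, E) 𝓘(ℝ, ℝ) ∞ (fun p => (P.Φ.symm p).1) :=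
      contMDiff_fst.comp P.Φ.symm.contMDiff
    have h2 : ContMDiff 𝓘(ℝ, E) 𝓘(ℝ, F) ∞ (fun p => (P.Φ.symm p).2) :=
      contMDiff_snd.comp P.Φ.symm.contMDiff
    have h3 : ContMDiffOn 𝓘(ℝ, E) 𝓘(ℝ, ℝ) ∞ (fun p => chartAt ℝ q.1 (P.Φ.symm p).1)
        (P.chart L q).source :=
      (contMDiffOn_chart (I := 𝓘(ℝ, ℝ)) (x := q.1)).comp h1.contMDiffOn fun p _ => by
        rw [Set.mem_preimage, interval_chart_source]; trivial
    have h4 : ContMDiffOn 𝓘(ℝ, E) 𝓘(ℝ, F) ∞ (fun p => chartAt F q.2 (P.Φ.symm p).2)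
        (P.chart L q).source :=
      (contMDiffOn_chart (I := 𝓘(ℝ, F)) (x := q.2)).comp h2.contMDiffOn fun p hp =>
        (P.mem_chart_source L q).1 hp
    exact L.contDiff.contMDiff.comp_contMDiffOn (h3.prodMk_space h4)
  · exact P.Φ.contMDiff.comp_contMDiffOn (P.contMDiffOn_chartSymm L q)

theorem mfderiv_chart_symm {y : E} (hy : y ∈ (P.chart L q).target) (u : E) :
    mfderiv 𝓘(ℝ, E) 𝓘(ℝ, E) (P.chart L q).symm y u =
      mfderiv (𝓘(ℝ, ℝ).prod 𝓘(ℝ, F)) 𝓘(ℝ, E) P.Φ (P.chartSymm L q y)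
        ((L.symm u).1, mfderiv 𝓘(ℝ, F) 𝓘(ℝ, F) (chartAt F q.2).symm (L.symm y).2 (L.symm u).2) := by
  obtain ⟨hy1, hy2⟩ := (P.mem_chart_target L q).1 hy
  have d1 : HasMFDerivAt 𝓘(ℝ, E) 𝓘(ℝ, ℝ) (fun y => (L.symm y).1) y
      ((ContinuousLinearMap.fst ℝ ℝ F).comp (L.symm : E →L[ℝ] ℝ × F)) :=
    ((ContinuousLinearMap.fst ℝ ℝ F).comp (L.symm : E →L[ℝ] ℝ × F)).hasFDerivAt.hasMFDerivAt
  have d2 : HasMFDerivAt 𝓘(ℝ, E) 𝓘(ℝ, F) (fun y => (L.symm y).2) y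
      ((ContinuousLinearMap.snd ℝ ℝ F).comp (L.symm : E →L[ℝ] ℝ × F)) :=
    ((ContinuousLinearMap.snd ℝ ℝ F).comp (L.symm : E →L[ℝ] ℝ × F)).hasFDerivAt.hasMFDerivAt
  have d3 := hasMFDerivAt_interval_chart_symm P.J q.1 (t := (L.symm y).1)
    (by rw [interval_chart_target]; exact hy1)
  have d4 : HasMFDerivAt 𝓘(ℝ, F) 𝓘(ℝ, F) (chartAt F q.2).symm (L.symm y).2 _ :=
    (((contMDiffOn_chart_symm (I := 𝓘(ℝ, F)) (n := ∞) (x := q.2)).contMDiffAt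
      ((chartAt F q.2).open_target.mem_nhds hy2)).mdifferentiableAt (by simp)).hasMFDerivAt
  have d5 : HasMFDerivAt 𝓘(ℝ, E) (𝓘(ℝ, ℝ).prod 𝓘(ℝ, F)) (P.chartSymm L q) y _ :=
    (HasMFDerivAt.comp y d3 d1).prodMk (HasMFDerivAt.comp y d4 d2)
  have d6 := (P.Φ.contMDiff.mdifferentiable (by simp) (P.chartSymm L q y)).hasMFDerivAt
  have d7 : HasMFDerivAt 𝓘(ℝ, E) 𝓘(ℝ, E) (P.Φ ∘ P.chartSymm L q) y _ := HasMFDerivAt.comp y d6 d5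
  have d8 : HasMFDerivAt 𝓘(ℝ, E) 𝓘(ℝ, E) (P.chart L q).symm y _ := d7
  rw [d8.mfderiv]
  rfl

theorem chartSymm_fst {y : E} (hy : y ∈ (P.chart L q).target) :
    (((P.chartSymm L q y).1 : P.J) : ℝ) = (L.symm y).1 :=
  (chartAt ℝ q.1).right_inv
    (by rw [interval_chart_target]; exact ((P.mem_chart_target L q).1 hy).1)

theorem timeField_chart_symm {y : E} (hy : y ∈ (P.chart L q).target) :
    P.timeField ((P.chart L q).symm y) =
      mfderiv 𝓘(ℝ, E) 𝓘(ℝ, E) (P.chart L q).symm y (L (1, 0)) := by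
  rw [P.mfderiv_chart_symm L q hy]
  refine (P.timeField_apply (P.chartSymm L q y)).trans ?_
  rw [L.symm_apply_apply]
  have h : mfderiv 𝓘(ℝ, F) 𝓘(ℝ, F) (chartAt F q.2).symm (L.symm y).2 (0 : F) = (0 : F) :=
    map_zero _
  exact congrArg (fun w : F =>
    mfderiv (𝓘(ℝ, ℝ).prod 𝓘(ℝ, F)) 𝓘(ℝ, E) P.Φ (P.chartSymm L q y) ((1 : ℝ), w)) h.symm

/-- The fibre metric in coordinates. -/
def fibreForm (y : E) : E →L[ℝ] E →L[ℝ] ℝ :=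
  ContinuousLinearMap.bilinearComp (E := F) (F := F) (E' := E) (F' := E)
    (P.h.inner ((chartAt F q.2).symm (L.symm y).2))
    ((mfderiv 𝓘(ℝ, F) 𝓘(ℝ, F) (chartAt F q.2).symm (L.symm y).2 : F →L[ℝ] F).comp
      ((ContinuousLinearMap.snd ℝ ℝ F).comp (L.symm : E →L[ℝ] ℝ × F)))
    ((mfderiv 𝓘(ℝ, F) 𝓘(ℝ, F) (chartAt F q.2).symm (L.symm y).2 : F →L[ℝ] F).comp
      ((ContinuousLinearMap.snd ℝ ℝ F).comp (L.symm : E →L[ℝ] ℝ × F)))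

theorem fibreForm_apply (y u v : E) : P.fibreForm L q y u v =
    P.h.inner ((chartAt F q.2).symm (L.symm y).2)
      (mfderiv 𝓘(ℝ, F) 𝓘(ℝ, F) (chartAt F q.2).symm (L.symm y).2 (L.symm u).2)
      (mfderiv 𝓘(ℝ, F) 𝓘(ℝ, F) (chartAt F q.2).symm (L.symm y).2 (L.symm v).2) := rfl

theorem inChart_eq {y : E} (hy : y ∈ (P.chart L q).target) (u v : E) :
    g.inChart (P.chart L q) y u v =
      -((L.symm u).1 * (L.symm v).1) + P.a (L.symm y).1 ^ 2 * P.fibreForm L q y u v := by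
  rw [g.inChart_apply, P.mfderiv_chart_symm L q hy, P.mfderiv_chart_symm L q hy,
    ← P.chartSymm_fst L q hy]
  exact P.metric_eq _ _ _ _ _ _

theorem fibreForm_pos {y : E} (hy : (L.symm y).2 ∈ (chartAt F q.2).target) {u : E}
    (hu : (L.symm u).1 = 0) (hne : u ≠ 0) : 0 < P.fibreForm L q y u u := by
  rw [fibreForm_apply]
  refine P.h.pos _ _ fun h0 => hne ?_
  have hm := mdifferentiable_of_mem_maximalAtlas
    (IsManifold.chart_mem_maximalAtlas (I := 𝓘(ℝ, F)) (n := ∞) q.2)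
  have h1 := hm.comp_symm_deriv hy
  have h2 : (L.symm u).2 = 0 := by
    have h3 := congrArg (fun l : F →L[ℝ] F => l (L.symm u).2) h1
    have h4 : (mfderiv 𝓘(ℝ, F) 𝓘(ℝ, F) (chartAt F q.2)
        ((chartAt F q.2).symm (L.symm y).2))
        (mfderiv 𝓘(ℝ, F) 𝓘(ℝ, F) (chartAt F q.2).symm (L.symm y).2 (L.symm u).2) =
        (L.symm u).2 := h3
    rw [← h4, h0]
    exact map_zero _
  have h5 : L.symm u = 0 := Prod.ext hu h2
  simpa using h5

theorem contDiffOn_fibreForm :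
    ContDiffOn ℝ ∞ (P.fibreForm L q) {y | (L.symm y).2 ∈ (chartAt F q.2).target} := by
  refine contDiffOn_clm_apply.2 fun u => contDiffOn_clm_apply.2 fun v => ?_
  have h1 := contDiffOn_form_chart P.h.contMDiff
    (IsManifold.chart_mem_maximalAtlas (I := 𝓘(ℝ, F)) (n := ∞) q.2) (L.symm u).2 (L.symm v).2
  have h2 : ContDiff ℝ ∞ (fun y => (L.symm y).2) := contDiff_snd.comp L.symm.contDiff
  exact h1.comp h2.contDiffOn fun y hy => hy

/-- A presentation as a GRW spacetime gives a warped splitting in every product chart. -/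
def splitting : WarpedSplitting E where
  T := (ContinuousLinearMap.fst ℝ ℝ F).comp (L.symm : E →L[ℝ] ℝ × F)
  r₀ := L (1, 0)
  T_r₀ := by simp
  H := P.fibreForm L q
  W := {y | (L.symm y).2 ∈ (chartAt F q.2).target}
  isOpen_W := (chartAt F q.2).open_target.preimage (continuous_snd.comp L.symm.continuous)
  add_mem y hy s := by simpa using hy
  H_symm y u v := by
    rw [fibreForm_apply, fibreForm_apply]
    exact P.h.symm _ _ _
  H_r₀ y u := by
    rw [fibreForm_apply, L.symm_apply_apply]
    have h : mfderiv 𝓘(ℝ, F) 𝓘(ℝ, F) (chartAt F q.2).symm (L.symm y).2 (0 : F) = (0 : F) :=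
      map_zero _
    exact (congrArg (P.h.inner _ _) h).trans (map_zero _)
  H_add y s := by
    have h : (L.symm (y + s • L (1, 0))).2 = (L.symm y).2 := by simp
    ext u v
    rw [fibreForm_apply, fibreForm_apply, h]
  H_pos y hy u hu hne := P.fibreForm_pos L q hy hu hne
  contDiffOn_H := P.contDiffOn_fibreForm L q
  J := P.J
  isOpen_J := P.J.isOpen
  a := P.a
  contDiffOn_a := P.a_contDiffOn
  a_pos := P.a_pos

theorem splitting_U : (P.splitting L q).U = (P.chart L q).target := by
  ext y
  rw [mem_chart_target]
  exact and_comm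

theorem inChart_eq_G {y : E} (hy : y ∈ (P.splitting L q).U) :
    g.inChart (P.chart L q) y = (P.splitting L q).G y := by
  ext u v
  rw [splitting_U] at hy
  rw [P.inChart_eq L q hy, WarpedSplitting.G, StaticSplitting.metric_apply]
  rfl

/-- Around every point there is a chart in which the metric is a warped product. -/
theorem exists_chart (p : M) : ∃ (e : OpenPartialHomeomorph M E) (S : WarpedSplitting E),
    e ∈ IsManifold.maximalAtlas 𝓘(ℝ, E) ∞ M ∧ p ∈ e.source ∧ e.target = S.U ∧ S.J = P.J ∧
      S.a = P.a ∧ (∀ y ∈ S.U, g.inChart e y = S.G y) ∧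
      ∀ y ∈ S.U, P.timeField (e.symm y) = mfderiv 𝓘(ℝ, E) 𝓘(ℝ, E) e.symm y S.r₀ := by
  let q := P.Φ.symm p
  -- Any linear isomorphism would serve; the derivative of Φ shows that there is one.
  let L : (ℝ × F) ≃L[ℝ] E := P.Φ.mfderivToContinuousLinearEquiv (by simp) q
  refine ⟨P.chart L q, P.splitting L q, P.chart_mem_maximalAtlas L q,
    (P.mem_chart_source L q).2 (_root_.mem_chart_source F q.2), (P.splitting_U L q).symm, rfl, rfl,
    fun y hy => P.inChart_eq_G L q hy, fun y hy => ?_⟩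
  rw [splitting_U] at hy
  exact P.timeField_chart_symm L q hy

end GRWPresentation

/-! ### The hypotheses expressed in a chart. -/

section ChartTransfer

variable {E : Type*} [NormedAddCommGroup E] [NormedSpace ℝ E] [FiniteDimensional ℝ E]
  {M : Type*} [TopologicalSpace M] [ChartedSpace E M] [IsManifold 𝓘(ℝ, E) ∞ M]
  {e : OpenPartialHomeomorph M E} (he : e ∈ IsManifold.maximalAtlas 𝓘(ℝ, E) ∞ M)

include he

theorem mfderiv_chart_mfderiv_symm {y : E} (hy : y ∈ e.target) (u : E) :
    (mfderiv 𝓘(ℝ, E) 𝓘(ℝ, E) e (e.symm y) (mfderiv 𝓘(ℝ, E) 𝓘(ℝ, E) e.symm y u) : E) = u :=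
  congrArg (fun l : E →L[ℝ] E => l u)
    ((mdifferentiable_of_mem_maximalAtlas he).comp_symm_deriv hy)

theorem exists_mfderiv_symm_eq {y : E} (hy : y ∈ e.target)
    (v : TangentSpace 𝓘(ℝ, E) (e.symm y)) :
    ∃ w : E, mfderiv 𝓘(ℝ, E) 𝓘(ℝ, E) e.symm y w = v := by
  have h := (mdifferentiable_of_mem_maximalAtlas he).symm_comp_deriv (e.map_target hy)
  refine ⟨mfderiv 𝓘(ℝ, E) 𝓘(ℝ, E) e (e.symm y) v, ?_⟩
  rw [e.right_inv hy] at h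
  exact congrArg (fun l : E →L[ℝ] E => l v) h

theorem soliton_chart {g : LorentzianMetric E M} {f : M → ℝ} {lam τ : ℝ}
    (hf : g.IsGradientTauEinsteinSoliton f lam τ) {y : E} (hy : y ∈ e.target) (u v : E) :
    Coord.hessian (g.inChart e) (f ∘ e.symm) y u v + Coord.ricci (g.inChart e) y u v =
      (lam + τ * Coord.scalarCurvature (g.inChart e) y) * g.inChart e y u v := by
  have h := hf.equation e he (e.symm y) (e.map_target hy)
    (mfderiv 𝓘(ℝ, E) 𝓘(ℝ, E) e.symm y u) (mfderiv 𝓘(ℝ, E) 𝓘(ℝ, E) e.symm y v)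
  rw [LorentzianMetric.hessian, LorentzianMetric.ricci, LorentzianMetric.scalarCurvature,
    mfderiv_chart_mfderiv_symm he hy, mfderiv_chart_mfderiv_symm he hy, e.right_inv hy] at h
  exact h

theorem ricci_eigenfield_chart {g : LorentzianMetric E M} {ξ : M → ℝ}
    {ρ : (p : M) → TangentSpace 𝓘(ℝ, E) p} (hξ : g.IsRicciEigenfield ρ ξ) {y : E}
    (hy : y ∈ e.target) {r : E} (hr : ρ (e.symm y) = mfderiv 𝓘(ℝ, E) 𝓘(ℝ, E) e.symm y r) (u : E) :
    Coord.ricci (g.inChart e) y u r = ξ (e.symm y) * g.inChart e y u r := by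
  have h := hξ e he (e.symm y) (e.map_target hy) (mfderiv 𝓘(ℝ, E) 𝓘(ℝ, E) e.symm y u)
  rw [LorentzianMetric.ricci, hr, mfderiv_chart_mfderiv_symm he hy,
    mfderiv_chart_mfderiv_symm he hy, e.right_inv hy] at h
  exact h

theorem differential_chart {f : M → ℝ} (hf : ContMDiff 𝓘(ℝ, E) 𝓘(ℝ, ℝ) ∞ f) {y : E}
    (hy : y ∈ e.target) (u : E) :
    LorentzianMetric.differential f (e.symm y) (mfderiv 𝓘(ℝ, E) 𝓘(ℝ, E) e.symm y u) =
      fderiv ℝ (f ∘ e.symm) y u := by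
  have h1 := (hf.mdifferentiable (by simp) (e.symm y)).hasMFDerivAt
  have h2 := ((mdifferentiable_of_mem_maximalAtlas he).mdifferentiableAt_symm hy).hasMFDerivAt
  have h3 := (HasMFDerivAt.comp y h1 h2).mfderiv
  rw [mfderiv_eq_fderiv] at h3
  rw [h3]
  rfl

end ChartTransfer

/-! ### From the charts back to the manifold. -/

namespace GRWPresentation

variable {E : Type*} [NormedAddCommGroup E] [NormedSpace ℝ E] [FiniteDimensional ℝ E]
  {M : Type*} [TopologicalSpace M] [ChartedSpace E M] [IsManifold 𝓘(ℝ, E) ∞ M]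
  {g : LorentzianMetric E M}
  {F : Type*} [NormedAddCommGroup F] [NormedSpace ℝ F]
  {N : Type*} [TopologicalSpace N] [ChartedSpace F N] [IsManifold 𝓘(ℝ, F) ∞ N]
  (P : GRWPresentation g F N)

/-- Evaluating the eigenvalue equation on (ρ, ρ) gives -(n-1)a''/a = -ξ, so a'' = 0 would force ξ =
0. -/
theorem exists_deriv_deriv_ne_zero {ξ : M → ℝ} (hξ : g.IsRicciEigenfield P.timeField ξ)
    (hξ_ne : ∃ p, ξ p ≠ 0) : ∃ t ∈ P.J, deriv (deriv P.a) t ≠ 0 := by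
  obtain ⟨p, hp⟩ := hξ_ne
  obtain ⟨e, S, he, hpe, hU, hJ, ha, hG, hρ⟩ := P.exists_chart p
  have hyt : e p ∈ e.target := e.map_source hpe
  have hy : e p ∈ S.U := hU ▸ hyt
  have h := ricci_eigenfield_chart he hξ hyt (hρ _ hy) S.r₀
  have hev : g.inChart e =ᶠ[𝓝 (e p)] S.G := by
    filter_upwards [S.isOpen_U.mem_nhds hy] with z hz using hG z hz
  rw [ricci_congr hev, hG _ hy, e.left_inv hpe, S.ricci_G hy, S.ricci_base_r₀ hy.1,
    WarpedSplitting.G, S.metric_apply, S.T_r₀, S.H_r₀] at h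
  have hJ' : S.T (e p) ∈ S.J := hy.2
  rw [hJ] at hJ'
  refine ⟨S.T (e p), hJ', fun h0 => hp ?_⟩
  rw [ha, h0] at h
  simpa using h.symm

theorem gradient_eq (hE : 2 ≤ Module.finrank ℝ E) {t : ℝ} (ht : t ∈ P.J)
    (hne : deriv (deriv P.a) t ≠ 0) {f : M → ℝ} {lam τ : ℝ}
    (hf : g.IsGradientTauEinsteinSoliton f lam τ) (p : M) :
    g.gradient f p =
      -(LorentzianMetric.differential f p (P.timeField p)) • P.timeField p := by
  obtain ⟨e, S, he, hpe, hU, hJ, ha, hG, hρ⟩ := P.exists_chart p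
  have hev : ∀ y ∈ S.U, g.inChart e =ᶠ[𝓝 y] S.G := fun y hy => by
    filter_upwards [S.isOpen_U.mem_nhds hy] with z hz using hG z hz
  let S' : SolitonSplitting E :=
    { S with
      ordConnected_J := hJ ▸ P.ordConnected
      φ := f ∘ e.symm
      lam := lam
      τ := τ
      contDiffOn_φ := by
        rw [← contMDiffOn_iff_contDiffOn]
        exact hf.contMDiff.comp_contMDiffOn (hU ▸ contMDiffOn_symm_of_mem_maximalAtlas he)
      soliton := fun y hy u v => by
        have h := soliton_chart he hf (hU ▸ hy : y ∈ e.target) u v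
        rw [hessian_congr (hev y hy), ricci_congr (hev y hy), scalarCurvature_congr (hev y hy),
          hG y hy] at h
        exact h }
  obtain ⟨y, hy, rfl⟩ : ∃ y ∈ e.target, e.symm y = p := ⟨e p, e.map_source hpe, e.left_inv hpe⟩
  have hyU : y ∈ S.U := hU ▸ hy
  have key : ∀ u, S.T u = 0 → fderiv ℝ (f ∘ e.symm) y u = 0 := fun u hu =>
    S'.fderiv_φ_eq_zero hE (t := t) (hJ ▸ ht : t ∈ S.J)
      (ha ▸ hne : deriv (deriv S.a) t ≠ 0) hyU hu
  have hsplit : ∀ w, fderiv ℝ (f ∘ e.symm) y w = S.T w * fderiv ℝ (f ∘ e.symm) y S.r₀ := by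
    intro w
    have h := key (S.proj w) (S.T_proj w)
    rw [S.proj_apply, map_sub, map_smul, smul_eq_mul] at h
    linarith
  -- Lowering the index of ρ gives -dt; this is the source of the minus sign in the conclusion.
  have hgrad : ∀ w : E, g.val (e.symm y) (P.timeField (e.symm y))
      (mfderiv 𝓘(ℝ, E) 𝓘(ℝ, E) e.symm y w) = -S.T w := by
    intro w
    rw [hρ y hyU]
    refine (g.inChart_apply e y S.r₀ w).symm.trans ?_
    rw [hG y hyU, WarpedSplitting.G, S.metric_apply, S.T_r₀, S.H_r₀_left]
    ring
  -- By nondegeneracy it suffices to compare covectors: df = (ρf)dt on both sides.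
  refine g.val_injective _ (ContinuousLinearMap.ext fun v => ?_)
  obtain ⟨w, rfl⟩ := exists_mfderiv_symm_eq he hy v
  rw [g.gradient_spec, differential_chart he hf.contMDiff hy, hsplit]
  rw [map_smul]
  refine Eq.trans ?_ (smul_apply _ _ _).symm
  rw [smul_eq_mul]
  refine Eq.trans ?_ (congrArg _ (hgrad w)).symm
  rw [hρ y hyU, differential_chart he hf.contMDiff hy]
  ring

end GRWPresentation

end

theorem mainTheorem5
    {E : Type*} [NormedAddCommGroup E] [NormedSpace ℝ E] [FiniteDimensional ℝ E]
    (hdim : 4 ≤ Module.finrank ℝ E)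
    {M : Type*} [TopologicalSpace M] [ChartedSpace E M] [IsManifold 𝓘(ℝ, E) ∞ M]
    (g : LorentzianMetric E M)
    {F : Type*} [NormedAddCommGroup F] [NormedSpace ℝ F]
    {N : Type*} [TopologicalSpace N] [ChartedSpace F N] [IsManifold 𝓘(ℝ, F) ∞ N]
    (P : GRWPresentation g F N)
    (ξ : M → ℝ) (hξ : g.IsRicciEigenfield P.timeField ξ) (hξ_ne : ∃ p, ξ p ≠ 0)
    (f : M → ℝ) (lam τ : ℝ) (hf : g.IsGradientTauEinsteinSoliton f lam τ) :
    ∀ p : M, g.gradient f p =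
      -(LorentzianMetric.differential f p (P.timeField p)) • P.timeField p := by
  obtain ⟨t, ht, hne⟩ := P.exists_deriv_deriv_ne_zero hξ hξ_ne
  exact P.gradient_eq (by omega) ht hne hf
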